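/- Let $0\le p\le 1$, $0\le q_1\le \tfrac12$ and $q_2\ge \tfrac12$. Consider the memoryless binary multiple access channel with state and output $Y=(Y_1,Y_2)$, $$Y_{1,i}=X_{1,i}\oplus S_i\oplus Z_{1,i},\qquad Y_{2,i}=X_{2,i},$$ where $(S_i)$ is i.i.d. $\mathrm{Bern}(\tfrac12)$, $(Z_{1,i})$ is i.i.d. $\mathrm{Bern}(p)$, and the two sequences are independent. A code of length $n\ge 1$ with $M$ messages consists of an Encoder 1 that maps the message $W$ (uniform on $M$ values, independent of the states and the noise) and the whole state sequence $S^n$ to $X_1^n$, of an Encoder 2 that has no message and at time $i$ maps only $S^{i-1}=(S_1,\dots,S_{i-1})$ to $X_{2,i}$, and of a decoder that estimates $W$ from $Y^n$; the inputs always have to satisfy $\sum_{i=1}^n X_{1,i}\le nq_1$ and $\sum_{i=1}^n X_{2,i}\le nq_2$. A rate $R\ge 0$ is achievable if for every $\epsilon>0$ there is, for some $n\ge 1$, a code with $M\ge 2^{nR}$ messages and average error probability at most $\epsilon$; the capacity $\mathcal C$ is the supremum of the achievable rates. Write $h(\alpha)=-\alpha\log_2\alpha-(1-\alpha)\log_2(1-\alpha)$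 and $p*q=p(1-q)+q(1-p)$. Then $$\mathcal C=h(p*q_1)-h(p).$$ If moreover $0<p<1$, $p\ne\tfrac12$ and $0<q_1<\tfrac12$, then the maximum of $I(U;Y_1)-I(U;S)$, where $Y_1=X_1\oplus S\oplus Z_1$ with $S\sim\mathrm{Bern}(\tfrac12)$ and with $Z_1\sim\mathrm{Bern}(p)$ independent of $(S,U,X_1)$, over all random variables $U$ with values in a finite set and all conditional laws $p(u,x_1|s)$ with $\mathbb E[X_1]\le q_1$, is attained, and $$\mathcal C> \max_{p(u,x_1|s):\ \mathbb E[X_1]\le q_1}\ I(U;Y_1)-I(U;S).$$ In this case strictly causal state knowledge at Encoder 2 helps: the capacity of the same channel, under the same constraints, when Encoder 2 does not know the states at all (while Encoder 1 still knows them non-causally) is strictly smaller than $\mathcal C$. -/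

import Mathlib

noncomputable section

namespace StateMAC

/-- A block code of length `n` with `Mc` common and `M1` individual messages for a multiple access
channel with states. Encoder 1 sees both messages and the entire state sequence; at time `i`
Encoder 2 sees the common message and only the states strictly before time `i`. -/
structure Code (S X1 X2 Y : Type) (Mc M1 n : ℕ) where
  enc1 : Fin Mc → Fin M1 → (Fin n → S) → Fin n → X1
  enc2 : (i : Fin n) → Fin Mc → (Fin (i : ℕ) → S) → X2
  dec : (Fin n → Y) → Fin Mc × Fin M1

namespace Code

variable {S X1 X2 Y : Type} {Mc M1 n : ℕ}

/-- The input sequence that Encoder 2 produces when the state sequence is `s`. -/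
def word2 (c : Code S X1 X2 Y Mc M1 n) (wc : Fin Mc) (s : Fin n → S) : Fin n → X2 :=
  fun i => c.enc2 i wc (fun j => s (Fin.castLE i.isLt.le j))

/-- The average probability of decoding error, for uniform independent messages, an i.i.d. state
with probability mass function `Q` and the memoryless channel `W x₁ x₂ s y = W(y | x₁, x₂, s)`. -/
def errorProb [Fintype S] [Fintype Y] (Q : S → ℝ) (W : X1 → X2 → S → Y → ℝ)
    (c : Code S X1 X2 Y Mc M1 n) : ℝ :=
  (1 / ((Mc : ℝ) * (M1 : ℝ))) * ∑ wc : Fin Mc, ∑ w1 : Fin M1, ∑ s : Fin n → S, ∑ y : Fin n → Y,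
    (∏ i, Q (s i) * W (c.enc1 wc w1 s i) (c.word2 wc s i) (s i) (y i)) *
      (if c.dec y ≠ (wc, w1) then 1 else 0)

/-- Encoder 2 makes no use of the states. -/
def Enc2IgnoresState (c : Code S X1 X2 Y Mc M1 n) : Prop :=
  ∀ (i : Fin n) (wc : Fin Mc) (t t' : Fin (i : ℕ) → S), c.enc2 i wc t = c.enc2 i wc t'

/-- The Hamming weight constraints on the binary channel inputs, with budgets `n q₁` and `n q₂`. -/
def MeetsConstraints {S Y : Type} {Mc M1 n : ℕ} (q1 q2 : ℝ)
    (c : Code S (ZMod 2) (ZMod 2) Y Mc M1 n) : Prop :=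
  (∀ wc w1 s, ∑ i, ((c.enc1 wc w1 s i).val : ℝ) ≤ n * q1) ∧
    (∀ wc s, ∑ i, ((c.word2 wc s i).val : ℝ) ≤ n * q2)

end Code

/-- The Bernoulli probability mass function on `{0, 1}`. -/
def bern (p : ℝ) (z : ZMod 2) : ℝ := if z = 1 then p else 1 - p

/-- The binary channel: `Y₁ = X₁ + S + Z₁` modulo 2 with `Z₁ ∼ Bern(p)`, and `Y₂ = X₂`. -/
def binaryMAC (p : ℝ) (x1 x2 s : ZMod 2) (y : ZMod 2 × ZMod 2) : ℝ :=
  ∑ z : ZMod 2, bern p z * (if y = (x1 + s + z, x2) then 1 else 0)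

/-- The channel to the first output component alone: `Y₁ = X₁ + S + Z₁` modulo 2. -/
def binaryY1 (p : ℝ) (x1 s y1 : ZMod 2) : ℝ :=
  ∑ z : ZMod 2, bern p z * (if y1 = x1 + s + z then 1 else 0)

/-- `R` (in bits per channel use) is achievable for the individual message of Encoder 1 over the
binary channel with `S ∼ Bern(1/2)`; Encoder 2 has no message and sees the states strictly
causally. -/
def Achievable (p q1 q2 R : ℝ) : Prop :=
  ∀ ε : ℝ, 0 < ε → ∃ (n M : ℕ) (c : Code (ZMod 2) (ZMod 2) (ZMod 2) (ZMod 2 × ZMod 2) 1 M n),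
    0 < n ∧ (2 : ℝ) ^ ((n : ℝ) * R) ≤ (M : ℝ) ∧ c.MeetsConstraints q1 q2 ∧
      c.errorProb (bern (1 / 2)) (binaryMAC p) ≤ ε

/-- The same as `Achievable`, except that Encoder 2 has no knowledge of the states. -/
def AchievableNoState (p q1 q2 R : ℝ) : Prop :=
  ∀ ε : ℝ, 0 < ε → ∃ (n M : ℕ) (c : Code (ZMod 2) (ZMod 2) (ZMod 2) (ZMod 2 × ZMod 2) 1 M n),
    0 < n ∧ (2 : ℝ) ^ ((n : ℝ) * R) ≤ (M : ℝ) ∧ c.MeetsConstraints q1 q2 ∧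
      c.Enc2IgnoresState ∧ c.errorProb (bern (1 / 2)) (binaryMAC p) ≤ ε

/-- `C` is the capacity: the supremum of the achievable nonnegative rates. -/
def IsCapacity (p q1 q2 C : ℝ) : Prop :=
  IsLUB {R : ℝ | 0 ≤ R ∧ Achievable p q1 q2 R} C

/-- `C` is the capacity when Encoder 2 has no knowledge of the states. -/
def IsCapacityNoState (p q1 q2 C : ℝ) : Prop :=
  IsLUB {R : ℝ | 0 ≤ R ∧ AchievableNoState p q1 q2 R} C

/-- The binary entropy function, in bits. -/
def h (a : ℝ) : ℝ := -(a * Real.logb 2 a) - (1 - a) * Real.logb 2 (1 - a)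

/-- Binary convolution `p ∗ q`. -/
def conv (p q : ℝ) : ℝ := p * (1 - q) + q * (1 - p)

/-- The mutual information, in bits, of a joint probability mass function on a finite product. -/
def mutualInfo {A B : Type} [Fintype A] [Fintype B] (P : A → B → ℝ) : ℝ :=
  ∑ a, ∑ b, P a b * Real.logb 2 (P a b / ((∑ b', P a b') * (∑ a', P a' b)))

/-- `K s u x = p(u, x₁ | s)` is a conditional probability mass function. -/
def IsCondPMF {k : ℕ} (K : ZMod 2 → Fin k → ZMod 2 → ℝ) : Prop :=
  (∀ s u x, 0 ≤ K s u x) ∧ ∀ s, ∑ u, ∑ x, K s u x = 1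

/-- The joint law of `(S, U, X₁, Y₁)`: `S ∼ Bern(1/2)`, then `p(u, x₁ | s)`, then the channel. -/
def gpJoint (p : ℝ) {k : ℕ} (K : ZMod 2 → Fin k → ZMod 2 → ℝ)
    (s : ZMod 2) (u : Fin k) (x y : ZMod 2) : ℝ :=
  bern (1 / 2) s * K s u x * binaryY1 p x s y

/-- `E[X₁]` under `gpJoint`. -/
def gpCost (p : ℝ) {k : ℕ} (K : ZMod 2 → Fin k → ZMod 2 → ℝ) : ℝ :=
  ∑ s, ∑ u, ∑ x, ∑ y, gpJoint p K s u x y * (x.val : ℝ)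

/-- `I(U; Y₁) - I(U; S)` under `gpJoint`. -/
def gpRate (p : ℝ) {k : ℕ} (K : ZMod 2 → Fin k → ZMod 2 → ℝ) : ℝ :=
  mutualInfo (fun u y => ∑ s, ∑ x, gpJoint p K s u x y) -
    mutualInfo (fun u s => ∑ x, ∑ y, gpJoint p K s u x y)

/-- The values `I(U; Y₁) - I(U; S)` over all finite alphabets of `U` and all `p(u, x₁ | s)` that meet
the input constraint `E[X₁] ≤ q₁`. -/
def gpRates (p q1 : ℝ) : Set ℝ :=
  {r | ∃ (k : ℕ) (K : ZMod 2 → Fin k → ZMod 2 → ℝ),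
    IsCondPMF K ∧ gpCost p K ≤ q1 ∧ r = gpRate p K}

end StateMAC

end

noncomputable section

namespace StateMAC

open Real Finset Filter Topology

/-! ### Binary entropy and the Bernoulli distribution -/

/-! Encoder 2 serves as a delayed state feed for the decoder. It repeats the previous state; the
decoder reads it off `Y₂` and cancels it from `Y₁`, which leaves a binary symmetric channel with
crossover p and weight budget q₁, whose capacity is `gain p q1`. A fair state has mean weight 1/2,
so q₂ ≥ 1/2 pays for the repetition up to fluctuations, which a short idle tail of the block absorbs
(`achievable_of_lt_gain`). The channel code comes from Feinstein's lemma with the weight bound made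
part of typicality, so that every codeword obeys it. Conversely, even a decoder that knows all
states learns about the message only through X₁ + Z₁, and Fano's inequality relative to Bern(p∗q₁)
outputs gives the same bound (`le_gain_of_achievable`).

For the strict inequality, I(U;Y₁) − I(U;S) = H(Y₁) − H(S) + [H(S|U) − H(Y₁|U)], and H(Y₁) ≤ 1 =
H(S), so the rate is at most an average of single-law gaps H(S) − H(Y₁); adding a uniform bit to the
state makes this an equality. With D = S + Y₁ = X₁ + Z₁, one has H(S) + h(p) ≤ H(S,Y₁) = H(D,Y₁) ≤
H(D) + H(Y₁), so a gap is at most `gain` at the cost of the law. Equality would make X₁ a function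
of S; at a cost strictly between 0 and 1/2 this means X₁ = S or X₁ = S + 1, where Y₁ is pure noise
up to complement and the gap is only h(cost) − h(p) (`entGap_le`). Strict concavity of `gain` puts
all gaps strictly below its tangent at q₁, hence also their mixtures (`gap_lt_gain`), and
compactness provides a maximum (`exists_isGreatest_gpRates`).

Without states at Encoder 2, `Y₂` is a fixed word. Replacing states by outputs one coordinate at a
time (`hybrid_step`) bounds n − H(Y₁ⁿ) for each message by n times the same maximum, so that maximum
bounds the capacity; its achievability is not needed. -/

lemma sum_bit {β : Type*} [AddCommMonoid β] (f : ZMod 2 → β) : ∑ x, f x = f 0 + f 1 :=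
  Fin.sum_univ_two f

lemma h_eq_binEntropy (a : ℝ) : h a = binEntropy a / log 2 := by
  rw [binEntropy_eq_negMulLog_add_negMulLog_one_sub]
  simp only [h, logb, negMulLog]
  ring

lemma log_two_pos : 0 < log 2 := Real.log_pos one_lt_two

lemma continuous_h : Continuous h := by
  have : h = fun a => binEntropy a / log 2 := funext h_eq_binEntropy
  rw [this]; fun_prop

lemma h_one_sub (a : ℝ) : h (1 - a) = h a := by
  rw [h_eq_binEntropy, h_eq_binEntropy, binEntropy_one_sub]

lemma h_strictConcaveOn : StrictConcaveOn ℝ (Set.Icc 0 1) h := by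
  refine ⟨convex_Icc 0 1, fun x hx y hy hxy a b ha hb hab => ?_⟩
  have := strictConcave_binEntropy.2 hx hy hxy ha hb hab
  simp only [smul_eq_mul] at this ⊢
  rw [h_eq_binEntropy, h_eq_binEntropy, h_eq_binEntropy, ← mul_div_assoc, ← mul_div_assoc,
    ← add_div]
  exact div_lt_div_of_pos_right this log_two_pos

lemma h_strictMonoOn : StrictMonoOn h (Set.Icc 0 (1 / 2)) := by
  intro x hx y hy hxy
  rw [h_eq_binEntropy, h_eq_binEntropy]
  rw [one_div] at hx hy
  exact div_lt_div_of_pos_right (binEntropy_strictMonoOn hx hy hxy) log_two_pos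

lemma h_nonneg {a : ℝ} (h0 : 0 ≤ a) (h1 : a ≤ 1) : 0 ≤ h a := by
  rw [h_eq_binEntropy]; exact div_nonneg (binEntropy_nonneg h0 h1) log_two_pos.le

lemma h_le_one (a : ℝ) : h a ≤ 1 := by
  rw [h_eq_binEntropy, div_le_one log_two_pos]; exact binEntropy_le_log_two

@[simp] lemma h_zero : h 0 = 0 := by simp [h]
@[simp] lemma h_one : h 1 = 0 := by simp [h]

lemma conv_comm (p q : ℝ) : conv p q = conv q p := by unfold conv; ring
@[simp] lemma conv_zero (p : ℝ) : conv p 0 = p := by unfold conv; ring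
lemma one_sub_conv (p q : ℝ) : conv (1 - p) q = 1 - conv p q := by unfold conv; ring

lemma conv_mem {p q : ℝ} (hp : p ∈ Set.Icc (0 : ℝ) 1) (hq : q ∈ Set.Icc (0 : ℝ) 1) :
    conv p q ∈ Set.Icc (0 : ℝ) 1 := by
  obtain ⟨h1, h2⟩ := hp
  obtain ⟨h3, h4⟩ := hq
  constructor <;> unfold conv <;>
    nlinarith [mul_nonneg h1 h3, mul_nonneg (sub_nonneg.2 h2) h3, mul_nonneg h1 (sub_nonneg.2 h4),
      mul_nonneg (sub_nonneg.2 h2) (sub_nonneg.2 h4)]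

lemma continuous_conv (p : ℝ) : Continuous (conv p) := by unfold conv; fun_prop

/-- The capacity-cost function of the binary symmetric channel. -/
def gain (p q : ℝ) : ℝ := h (conv p q) - h p

lemma gain_one_sub_left (p q : ℝ) : gain (1 - p) q = gain p q := by
  rw [gain, gain, one_sub_conv, h_one_sub, h_one_sub]

lemma continuous_gain (p : ℝ) : Continuous (gain p) :=
  (continuous_h.comp (continuous_conv p)).sub continuous_const

@[simp] lemma gain_zero (p : ℝ) : gain p 0 = 0 := by simp [gain]

/-- Complementing p changes nothing, so p ≤ 1/2 may be assumed; then `conv p` increases and stays in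
[0, 1/2], where h increases. -/
lemma gain_mono {p q q' : ℝ} (hp : p ∈ Set.Icc (0 : ℝ) 1) (hq : 0 ≤ q) (hqq : q ≤ q')
    (hq' : q' ≤ 1 / 2) : gain p q ≤ gain p q' := by
  wlog hp2 : p ≤ 1 / 2 generalizing p
  · rw [← gain_one_sub_left p, ← gain_one_sub_left p]
    exact this ⟨by linarith [hp.2], by linarith [hp.1]⟩ (by linarith)
  unfold gain
  have h1 : conv p q ≤ conv p q' := by unfold conv; nlinarith
  have h2 : 0 ≤ conv p q := (conv_mem hp ⟨hq, by linarith⟩).1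
  have h3 : conv p q' ≤ 1 / 2 := by unfold conv; nlinarith
  have := h_strictMonoOn.monotoneOn ⟨h2, h1.trans h3⟩ ⟨h2.trans h1, h3⟩ h1
  linarith

/-- For p ≠ 1/2 the map `conv p` is affine and injective, so strict concavity passes over from h. -/
lemma gain_strictConcaveOn {p : ℝ} (hp0 : 0 ≤ p) (hp1 : p ≤ 1) (hp : p ≠ 1 / 2) :
    StrictConcaveOn ℝ (Set.Icc 0 1) (gain p) := by
  refine ⟨convex_Icc 0 1, fun x hx y hy hxy a b ha hb hab => ?_⟩
  have hne : conv p x ≠ conv p y := by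
    intro he
    have : (1 - 2 * p) * (x - y) = 0 := by unfold conv at he; linarith
    rcases mul_eq_zero.1 this with h' | h'
    · exact hp (by linarith)
    · exact hxy (by linarith)
  have := h_strictConcaveOn.2 (conv_mem ⟨hp0, hp1⟩ hx) (conv_mem ⟨hp0, hp1⟩ hy) hne ha hb hab
  have he : conv p (a • x + b • y) = a • conv p x + b • conv p y := by
    simp only [conv, smul_eq_mul]
    linear_combination -p * hab
  simp only [gain]
  rw [he]
  simp only [smul_eq_mul] at this ⊢
  have h3 : a * h p + b * h p = h p := by rw [← add_mul, hab, one_mul]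
  linarith

lemma bern_nonneg {p : ℝ} (hp : p ∈ Set.Icc (0 : ℝ) 1) (z : ZMod 2) : 0 ≤ bern p z := by
  unfold bern; split_ifs <;> linarith [hp.1, hp.2]

@[simp] lemma bern_apply_zero (p : ℝ) : bern p 0 = 1 - p := by simp [bern]
@[simp] lemma bern_apply_one (p : ℝ) : bern p 1 = p := by simp [bern]

@[simp] lemma sum_bern (p : ℝ) : ∑ z, bern p z = 1 := by simp [sum_bit]

lemma bern_half (z : ZMod 2) : bern (1 / 2) z = 1 / 2 := by unfold bern; split_ifs <;> norm_num

lemma bit_cases (x : ZMod 2) : x = 0 ∨ x = 1 := by revert x; decide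

lemma bit_val_nonneg (x : ZMod 2) : (0 : ℝ) ≤ (x.val : ℝ) := Nat.cast_nonneg _

@[simp] lemma bit_one_add_one : (1 : ZMod 2) + 1 = 0 := by decide

lemma bit_add_self (x : ZMod 2) : x + x = 0 := by revert x; decide

lemma bit_val_zero : ((0 : ZMod 2).val : ℝ) = 0 := by rw [ZMod.val_zero, Nat.cast_zero]

lemma bit_val_one : ((1 : ZMod 2).val : ℝ) = 1 := by rw [ZMod.val_one, Nat.cast_one]

lemma conv_bern (p q : ℝ) (y : ZMod 2) :
    ∑ x, bern q x * bern p (y + x) = bern (conv p q) y := by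
  rcases bit_cases y with rfl | rfl <;> simp [sum_bit, conv] <;> ring

/-! ### Sums over product distributions -/

lemma sum_prod_apply {A : Type*} [Fintype A] {n : ℕ} (f : Fin n → A → ℝ) :
    ∑ x : Fin n → A, ∏ i, f i (x i) = ∏ i, ∑ a, f i a := by
  classical
  rw [Finset.prod_univ_sum, Fintype.piFinset_univ]

lemma sum_prod_one {A : Type*} [Fintype A] {n : ℕ} {f : Fin n → A → ℝ}
    (hf : ∀ i, ∑ a, f i a = 1) : ∑ x : Fin n → A, ∏ i, f i (x i) = 1 := by
  rw [sum_prod_apply]; simp [hf]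

lemma sum_prod_mul_apply {A : Type*} [Fintype A] {n : ℕ} {f : Fin n → A → ℝ}
    (hf : ∀ i, ∑ a, f i a = 1) (j : Fin n) (g : A → ℝ) :
    ∑ x : Fin n → A, (∏ i, f i (x i)) * g (x j) = ∑ a, f j a * g a := by
  classical
  have : ∀ x : Fin n → A, (∏ i, f i (x i)) * g (x j) =
      ∏ i, (if i = j then f i (x i) * g (x i) else f i (x i)) := by
    intro x
    rw [← Finset.mul_prod_erase _ _ (mem_univ j), ← Finset.mul_prod_erase univ
      (fun i => if i = j then f i (x i) * g (x i) else f i (x i)) (mem_univ j)]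
    simp only [if_true]
    rw [mul_right_comm]
    congr 1
    refine Finset.prod_congr rfl fun i hi => ?_
    rw [if_neg (Finset.ne_of_mem_erase hi)]
  simp_rw [this]
  rw [sum_prod_apply (fun i a => if i = j then f i a * g a else f i a),
    ← Finset.mul_prod_erase _ _ (mem_univ j)]
  simp only [if_true]
  rw [Finset.prod_eq_one, mul_one]
  intro i hi
  simp [Finset.ne_of_mem_erase hi, hf]

lemma sum_prod_mul_sum_sq {A : Type*} [Fintype A] (P g : A → ℝ) (hP : ∑ a, P a = 1)
    (hg : ∑ a, P a * g a = 0) (n : ℕ) :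
    ∑ x : Fin n → A, (∏ i, P (x i)) * (∑ i, g (x i)) ^ 2 = n * ∑ a, P a * g a ^ 2 := by
  induction n with
  | zero => simp
  | succ n ih =>
    rw [← (Fin.consEquiv fun _ : Fin (n + 1) => A).sum_comp, Fintype.sum_prod_type]
    simp only [Fin.consEquiv_apply, Fin.prod_univ_succ, Fin.sum_univ_succ, Fin.cons_zero,
      Fin.cons_succ]
    have h1 : ∀ (a : A) (x : Fin n → A),
        P a * (∏ i, P (x i)) * (g a + ∑ i, g (x i)) ^ 2 =
          P a * g a ^ 2 * (∏ i, P (x i)) + 2 * ((P a * g a) * ((∏ i, P (x i)) * ∑ i, g (x i))) +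
            P a * ((∏ i, P (x i)) * (∑ i, g (x i)) ^ 2) := by
      intros; ring
    simp_rw [h1, Finset.sum_add_distrib, ← Finset.mul_sum, ← Finset.sum_mul, ih]
    rw [sum_prod_one (f := fun _ => P) (fun _ => hP), hP, hg]
    push_cast
    ring

/-- Chebyshev's inequality for i.i.d. sums. -/
lemma chebyshev_iid {A : Type*} [Fintype A] (P f : A → ℝ) (hP0 : ∀ a, 0 ≤ P a) (hP : ∑ a, P a = 1)
    (n : ℕ) {δ : ℝ} (hδ : 0 < δ) (hn : 0 < n) (B : Set (Fin n → A)) [DecidablePred (· ∈ B)]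
    (hB : ∀ x ∈ B, (∏ i, P (x i)) ≠ 0 → n * δ ≤ |∑ i, f (x i) - n * ∑ a, P a * f a|) :
    ∑ x : Fin n → A, (∏ i, P (x i)) * (if x ∈ B then 1 else 0) ≤
      (∑ a, P a * (f a - ∑ b, P b * f b) ^ 2) / (n * δ ^ 2) := by
  have hn' : (0 : ℝ) < n := by exact_mod_cast hn
  set μ := ∑ b, P b * f b with hμ
  have hg : ∑ a, P a * (f a - μ) = 0 := by
    simp_rw [mul_sub, Finset.sum_sub_distrib, ← Finset.sum_mul, hP]; simp [hμ]
  have key := sum_prod_mul_sum_sq P (fun a => f a - μ) hP hg n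
  rw [le_div_iff₀ (by positivity)]
  have : (∑ x : Fin n → A, (∏ i, P (x i)) * (if x ∈ B then 1 else 0)) * (n * δ) ^ 2 ≤
      ∑ x : Fin n → A, (∏ i, P (x i)) * (∑ i, (f (x i) - μ)) ^ 2 := by
    rw [Finset.sum_mul]
    refine Finset.sum_le_sum fun x _ => ?_
    have hprod : 0 ≤ ∏ i, P (x i) := Finset.prod_nonneg fun i _ => hP0 _
    by_cases hx : x ∈ B
    · rw [if_pos hx, mul_one]
      -- Points of probability zero are exempt from `hB`: the log-densities used later are
      -- meaningful only on the support.
      by_cases h0 : ∏ i, P (x i) = 0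
      · simp [h0]
      · refine mul_le_mul_of_nonneg_left ?_ hprod
        have h2 := hB x hx h0
        have h3 : ∑ i, (f (x i) - μ) = ∑ i, f (x i) - n * μ := by
          rw [Finset.sum_sub_distrib]; simp
        rw [h3, ← sq_abs (_ - _)]
        exact pow_le_pow_left₀ (by positivity) h2 2
    · rw [if_neg hx]
      simp only [mul_zero, zero_mul]
      positivity
  rw [key] at this
  have h4 : n * ((∑ x : Fin n → A, (∏ i, P (x i)) * (if x ∈ B then 1 else 0)) * (n * δ ^ 2)) ≤
      n * ∑ a, P a * (f a - μ) ^ 2 := by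
    calc _ = _ := by ring
      _ ≤ _ := this
  exact le_of_mul_le_mul_left h4 hn'

lemma tendsto_chebyshev_bound (V δ : ℝ) :
    Tendsto (fun n : ℕ => V / (n * δ ^ 2)) atTop (𝓝 0) := by
  have : Tendsto (fun n : ℕ => (V / δ ^ 2) / (n : ℝ)) atTop (𝓝 0) :=
    tendsto_const_div_atTop_nhds_zero_nat _
  refine this.congr fun n => ?_
  rw [div_div, mul_comm]

/-! ### Feinstein's maximal coding lemma -/

section Feinstein
variable {X Y : Type*} [Fintype X] [Fintype Y] [DecidableEq Y]

/-- Greedy extension. If no further codeword fits, every input has typical mass below 1 − ε outside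
the region U already used. Each decoding set consists of typical outputs and so has output mass at
most 1/θ, whence U has mass at most N/θ. Averaging over inputs contradicts `hN`. -/
lemma exists_maximal_code (PX : X → ℝ) (W : X → Y → ℝ) (T : X → Y → Prop)
    [∀ x y, Decidable (T x y)] {θ ε : ℝ} (hPX : ∀ x, 0 ≤ PX x) (hPX1 : ∑ x, PX x = 1)
    (hW : ∀ x y, 0 ≤ W x y) (hW1 : ∀ x, ∑ y, W x y = 1) (hθ : 0 < θ)
    (hT : ∀ x y, T x y → θ * ∑ x', PX x' * W x' y ≤ W x y) (N : ℕ)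
    (hN : N / θ + (1 - ε) < ∑ x, ∑ y, PX x * W x y * (if T x y then 1 else 0)) :
    ∃ (c : ℕ → X) (D : ℕ → Finset Y),
      (∀ i < N, ∀ j < N, i ≠ j → Disjoint (D i) (D j)) ∧ (∀ i < N, ∀ y ∈ D i, T (c i) y) ∧
      ∀ i < N, 1 - ε ≤ ∑ y ∈ D i, W (c i) y := by
  induction N with
  | zero =>
    have : Nonempty X := by
      by_contra hX
      rw [not_nonempty_iff] at hX
      simp at hPX1
    exact ⟨fun _ => Classical.arbitrary X, fun _ => ∅, by simp, by simp, by simp⟩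
  | succ N ih =>
    obtain ⟨c, D, h1, h2, h3⟩ := ih (lt_of_le_of_lt (by gcongr; simp) hN)
    set U : Finset Y := (range N).biUnion D with hU
    have hUmass : ∑ y ∈ U, ∑ x, PX x * W x y ≤ N / θ := by
      calc ∑ y ∈ U, ∑ x, PX x * W x y ≤ ∑ i ∈ range N, ∑ y ∈ D i, ∑ x, PX x * W x y := by
            rw [hU, Finset.sum_biUnion]
            intro i hi j hj hij
            exact h1 i (by simpa using hi) j (by simpa using hj) hij
        _ ≤ ∑ i ∈ range N, 1 / θ := by
            refine Finset.sum_le_sum fun i hi => ?_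
            rw [le_div_iff₀ hθ, mul_comm, Finset.mul_sum]
            calc _ ≤ ∑ y ∈ D i, W (c i) y :=
                  Finset.sum_le_sum fun y hy => hT _ _ (h2 i (by simpa using hi) y hy)
              _ ≤ ∑ y, W (c i) y :=
                  Finset.sum_le_sum_of_subset_of_nonneg (subset_univ _) fun y _ _ => hW _ _
              _ = 1 := hW1 _
        _ = N / θ := by simp [div_eq_mul_inv]
    have hex : ∃ x, 1 - ε ≤ ∑ y ∈ univ.filter (fun y => T x y ∧ y ∉ U), W x y := by
      by_contra hcon
      push Not at hcon
      have hle : ∑ x, ∑ y, PX x * W x y * (if T x y then 1 else 0) ≤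
          ∑ x, PX x * ∑ y ∈ univ.filter (fun y => T x y ∧ y ∉ U), W x y +
            ∑ y ∈ U, ∑ x, PX x * W x y := by
        rw [Finset.sum_comm (s := U), ← Finset.sum_add_distrib]
        refine Finset.sum_le_sum fun x _ => ?_
        rw [Finset.mul_sum, Finset.sum_filter, ← Finset.sum_filter_add_sum_filter_not univ (· ∈ U),
          Finset.filter_mem_eq_inter, Finset.univ_inter, add_comm]
        refine add_le_add ?_ (Finset.sum_le_sum fun y _ => ?_)
        · rw [Finset.sum_filter]
          refine Finset.sum_le_sum fun y _ => ?_
          by_cases hy : y ∈ U <;> by_cases hT' : T x y <;> simp [hy, hT']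
        · have := mul_nonneg (hPX x) (hW x y)
          split_ifs <;> simp [this]
      have h4 : ∑ x, PX x * ∑ y ∈ univ.filter (fun y => T x y ∧ y ∉ U), W x y ≤
          ∑ x, PX x * (1 - ε) :=
        Finset.sum_le_sum fun x _ => mul_le_mul_of_nonneg_left (hcon x).le (hPX x)
      rw [← Finset.sum_mul, hPX1, one_mul] at h4
      have : (N : ℝ) / θ ≤ ((N + 1 : ℕ) : ℝ) / θ := by gcongr; simp
      linarith
    obtain ⟨x, hx⟩ := hex
    have hdisj : ∀ i < N, Disjoint (D i) (univ.filter (fun y => T x y ∧ y ∉ U)) := by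
      intro i hi
      rw [Finset.disjoint_left]
      intro y hy hy'
      exact (mem_filter.1 hy').2.2 (mem_biUnion.2 ⟨i, by simpa using hi, hy⟩)
    refine ⟨Function.update c N x, Function.update D N (univ.filter (fun y => T x y ∧ y ∉ U)),
      ?_, ?_, ?_⟩
    · intro i hi j hj hij
      rcases Nat.lt_succ_iff_lt_or_eq.1 hi with hi | rfl <;>
        rcases Nat.lt_succ_iff_lt_or_eq.1 hj with hj | rfl
      · simpa [hi.ne, hj.ne] using h1 i hi j hj hij
      · simpa [hi.ne] using hdisj i hi
      · simpa [hj.ne] using (hdisj j hj).symm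
      · exact absurd rfl hij
    · intro i hi y hy
      rcases Nat.lt_succ_iff_lt_or_eq.1 hi with hi | rfl
      · simp only [Function.update_of_ne hi.ne] at hy ⊢
        exact h2 i hi y hy
      · simp only [Function.update_self, mem_filter] at hy ⊢
        exact hy.2.1
    · intro i hi
      rcases Nat.lt_succ_iff_lt_or_eq.1 hi with hi | rfl
      · simpa only [Function.update_of_ne hi.ne] using h3 i hi
      · simpa only [Function.update_self] using hx

/-- Feinstein's lemma: a code all of whose codewords are typical with some output. -/
lemma feinstein (PX : X → ℝ) (W : X → Y → ℝ) (T : X → Y → Prop)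
    [∀ x y, Decidable (T x y)] {θ ε : ℝ} (hPX : ∀ x, 0 ≤ PX x) (hPX1 : ∑ x, PX x = 1)
    (hW : ∀ x y, 0 ≤ W x y) (hW1 : ∀ x, ∑ y, W x y = 1) (hθ : 0 < θ) (hε : ε < 1)
    (hT : ∀ x y, T x y → θ * ∑ x', PX x' * W x' y ≤ W x y) {N : ℕ} (hN0 : 0 < N)
    (hN : N / θ + (1 - ε) < ∑ x, ∑ y, PX x * W x y * (if T x y then 1 else 0)) :
    ∃ (c : Fin N → X) (dec : Y → Fin N), (∀ i, ∃ y, T (c i) y) ∧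
      ∀ i, ∑ y, W (c i) y * (if dec y ≠ i then 1 else 0) ≤ ε := by
  classical
  obtain ⟨c, D, h1, h2, h3⟩ := exists_maximal_code PX W T hPX hPX1 hW hW1 hθ hT N hN
  refine ⟨fun i => c i, fun y => if hy : ∃ i : Fin N, y ∈ D i then hy.choose else ⟨0, hN0⟩,
    fun i => ?_, fun i => ?_⟩
  -- Since ε < 1, a decoding set cannot be empty, and its elements witness typicality of the
  -- codeword.
  · by_contra hcon
    push Not at hcon
    have : D i = ∅ := Finset.eq_empty_of_forall_notMem fun y hy => hcon y (h2 i i.2 y hy)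
    have h4 := h3 i i.2
    rw [this, Finset.sum_empty] at h4
    linarith
  · have hdec : ∀ y ∈ D i,
        (if hy : ∃ i : Fin N, y ∈ D i then hy.choose else ⟨0, hN0⟩) = i := by
      intro y hy
      have hy' : ∃ i : Fin N, y ∈ D i := ⟨i, hy⟩
      rw [dif_pos hy']
      by_contra hne
      exact Finset.disjoint_left.1 (h1 _ hy'.choose.2 i i.2 (fun he => hne (Fin.ext he)))
        hy'.choose_spec hy
    have hle : ∑ y, W (c i) y * (if (if hy : ∃ i : Fin N, y ∈ D i then hy.choose else ⟨0, hN0⟩) ≠ i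
        then 1 else 0) ≤ ∑ y, W (c i) y * (if y ∈ D i then 0 else 1) := by
      refine Finset.sum_le_sum fun y _ => mul_le_mul_of_nonneg_left ?_ (hW _ _)
      by_cases hy : y ∈ D i
      · simp [hy, hdec y hy]
      · rw [if_neg hy]; split_ifs <;> simp
    have hsplit : ∑ y, W (c i) y * (if y ∈ D i then 0 else 1) =
        1 - ∑ y ∈ D i, W (c i) y := by
      have h5 := Finset.sum_filter_add_sum_filter_not univ (· ∈ D i) (fun y => W (c i) y)
      rw [hW1, Finset.filter_mem_eq_inter, Finset.univ_inter, Finset.sum_filter] at h5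
      have h6 : ∑ y, W (c i) y * (if y ∈ D i then 0 else 1) =
          ∑ y, if y ∉ D i then W (c i) y else 0 := by
        refine Finset.sum_congr rfl fun y _ => ?_
        by_cases hy : y ∈ D i <;> simp [hy]
      linarith
    have := h3 i i.2
    linarith

end Feinstein

/-! ### The binary symmetric channel with a weight constraint -/

lemma bsc_joint_sum (p q : ℝ) :
    ∑ a : ZMod 2 × ZMod 2, bern q a.1 * bern p (a.2 + a.1) = 1 := by
  rw [Fintype.sum_prod_type]
  simp [sum_bit]
  ring

lemma bsc_mean_weight (p q : ℝ) :
    ∑ a : ZMod 2 × ZMod 2, bern q a.1 * bern p (a.2 + a.1) * (a.1.val : ℝ) = q := by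
  rw [Fintype.sum_prod_type]
  simp only [sum_bit, bit_val_one, bit_val_zero]
  simp
  ring

lemma mul_logb_div (x : ℝ) {y : ℝ} (hy : y ≠ 0) :
    x * logb 2 (x / y) = x * logb 2 x - x * logb 2 y := by
  by_cases hx : x = 0
  · simp [hx]
  · rw [logb_div hx hy]; ring

lemma bsc_mean_density {p q : ℝ} (h0 : conv p q ≠ 0) (h1 : 1 - conv p q ≠ 0) :
    ∑ a : ZMod 2 × ZMod 2, bern q a.1 * bern p (a.2 + a.1) *
      logb 2 (bern p (a.2 + a.1) / bern (conv p q) a.2) = gain p q := by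
  rw [Fintype.sum_prod_type]
  have hne : ∀ y, bern (conv p q) y ≠ 0 := by
    intro y; rcases bit_cases y with rfl | rfl <;> simpa
  simp only [mul_assoc, mul_logb_div _ (hne _)]
  simp only [sum_bit, add_zero, zero_add, bit_one_add_one, bern_apply_zero, bern_apply_one, gain, h]
  simp only [conv]
  ring

lemma conv_mem_Ioo {p q : ℝ} (hp : p ∈ Set.Icc (0 : ℝ) 1) (hq : q ∈ Set.Ioo (0 : ℝ) 1) :
    conv p q ∈ Set.Ioo (0 : ℝ) 1 := by
  obtain ⟨h1, h2⟩ := hp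
  obtain ⟨h3, h4⟩ := hq
  unfold conv
  constructor
  · rcases h1.eq_or_lt with rfl | h1
    · simpa
    · nlinarith [mul_pos h1 (sub_pos.2 h4), mul_nonneg (sub_nonneg.2 h2) h3.le]
  · rcases h1.eq_or_lt with rfl | h1
    · simpa
    · nlinarith [mul_pos h1 h3, mul_nonneg (sub_nonneg.2 h2) (sub_nonneg.2 h4.le)]

/-- The second moment of a single-letter function around its mean. -/
def varOf {A : Type*} [Fintype A] (P f : A → ℝ) : ℝ := ∑ a, P a * (f a - ∑ b, P b * f b) ^ 2

/-- The typical pairs: the input obeys the weight constraint and the information density is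
at least `m γ`. -/
def BscTypical (p q q1 γ : ℝ) {m : ℕ} (x y : Fin m → ZMod 2) : Prop :=
  ∑ i, ((x i).val : ℝ) ≤ m * q1 ∧
    (2 : ℝ) ^ ((m : ℝ) * γ) * ∏ i, bern (conv p q) (y i) ≤ ∏ i, bern p (y i + x i)

-- Two Chebyshev bounds: the mean weight q lies strictly below q₁ and the mean density `gain p q`
-- strictly above γ, so each condition fails with probability of order 1/m.
open Classical in
lemma bsc_typical_mass {p q q1 γ : ℝ} (hp : p ∈ Set.Icc (0 : ℝ) 1) (hq : q ∈ Set.Ioo (0 : ℝ) 1)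
    (hqq : q < q1) (hγ : γ < gain p q) {m : ℕ} (hm : 0 < m) :
    1 - varOf (fun a : ZMod 2 × ZMod 2 => bern q a.1 * bern p (a.2 + a.1)) (fun a => a.1.val) /
        (m * (q1 - q) ^ 2) -
      varOf (fun a : ZMod 2 × ZMod 2 => bern q a.1 * bern p (a.2 + a.1))
        (fun a => logb 2 (bern p (a.2 + a.1) / bern (conv p q) a.2)) /
        (m * (gain p q - γ) ^ 2) ≤
    ∑ x : Fin m → ZMod 2, ∑ y : Fin m → ZMod 2, (∏ i, bern q (x i)) * (∏ i, bern p (y i + x i)) *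
      (if BscTypical p q q1 γ x y then 1 else 0) := by
  set P : ZMod 2 × ZMod 2 → ℝ := fun a => bern q a.1 * bern p (a.2 + a.1) with hPdef
  obtain ⟨hc0, hc1⟩ := conv_mem_Ioo hp hq
  have hPY : ∀ y, 0 < bern (conv p q) y := by
    intro y; rcases bit_cases y with rfl | rfl <;> simp [hc0, hc1]
  have hq' : q ∈ Set.Icc (0 : ℝ) 1 := ⟨hq.1.le, hq.2.le⟩
  have hP0 : ∀ a, 0 ≤ P a := fun a => mul_nonneg (bern_nonneg hq' _) (bern_nonneg hp _)
  have hP1 : ∑ a, P a = 1 := bsc_joint_sum p q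
  have b1 := chebyshev_iid P (fun a => (a.1.val : ℝ)) hP0 hP1 m (sub_pos.2 hqq) hm
    {a | m * q1 < ∑ i, ((a i).1.val : ℝ)} (by
      intro a ha _
      rw [bsc_mean_weight p q]
      refine le_trans ?_ (le_abs_self _)
      have : m * q1 < ∑ i, ((a i).1.val : ℝ) := ha
      linarith)
  have b2 := chebyshev_iid P (fun a => logb 2 (bern p (a.2 + a.1) / bern (conv p q) a.2))
    hP0 hP1 m (sub_pos.2 hγ) hm
    {a | ¬ (2 : ℝ) ^ ((m : ℝ) * γ) * ∏ i, bern (conv p q) (a i).2 ≤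
      ∏ i, bern p ((a i).2 + (a i).1)} (by
      intro a ha hne
      rw [bsc_mean_density hc0.ne' (by linarith)]
      have ha' : ∏ i, bern p ((a i).2 + (a i).1) <
        (2 : ℝ) ^ ((m : ℝ) * γ) * ∏ i, bern (conv p q) (a i).2 := not_le.1 ha
      have hW : ∀ i, bern p ((a i).2 + (a i).1) ≠ 0 := by
        intro i hi
        exact Finset.prod_ne_zero_iff.1 hne i (mem_univ i) (by simp [hPdef, hi])
      rw [← logb_prod _ _ (fun i _ => div_ne_zero (hW i) (hPY _).ne'), Finset.prod_div_distrib]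
      have hWpos : 0 < ∏ i, bern p ((a i).2 + (a i).1) :=
        Finset.prod_pos fun i _ => lt_of_le_of_ne (bern_nonneg hp _) (hW i).symm
      have hYpos : 0 < ∏ i, bern (conv p q) (a i).2 := Finset.prod_pos fun i _ => hPY _
      have : logb 2 ((∏ i, bern p ((a i).2 + (a i).1)) / ∏ i, bern (conv p q) (a i).2) ≤ m * γ := by
        rw [logb_le_iff_le_rpow one_lt_two (div_pos hWpos hYpos), div_le_iff₀ hYpos]
        exact ha'.le
      rw [abs_sub_comm]
      refine le_trans ?_ (le_abs_self _)
      linarith)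
  have htot : ∑ a : Fin m → ZMod 2 × ZMod 2, ∏ i, P (a i) = 1 :=
    sum_prod_one (f := fun _ => P) fun _ => hP1
  rw [← Fintype.sum_prod_type', ← (Equiv.arrowProdEquivProdArrow (Fin m) _ _).sum_comp]
  simp only [Equiv.arrowProdEquivProdArrow_apply, ← Finset.prod_mul_distrib]
  change _ ≤ ∑ a : Fin m → ZMod 2 × ZMod 2, (∏ i, P (a i)) * _
  simp only [varOf]
  refine le_trans (sub_le_sub (sub_le_sub htot.ge b1) b2) ?_
  rw [← Finset.sum_sub_distrib, ← Finset.sum_sub_distrib]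
  refine Finset.sum_le_sum fun a _ => ?_
  have hpr : 0 ≤ ∏ i, P (a i) := Finset.prod_nonneg fun i _ => hP0 _
  simp only [Set.mem_ofPred_eq, BscTypical]
  by_cases h1 : m * q1 < ∑ i, ((a i).1.val : ℝ)
  · simp only [h1, not_le.2 h1, false_and, if_true, if_false]
    split_ifs <;> linarith
  · by_cases h2 : (2 : ℝ) ^ ((m : ℝ) * γ) * ∏ i, bern (conv p q) (a i).2 ≤
      ∏ i, bern p ((a i).2 + (a i).1)
    · simp only [h1, h2, not_lt.1 h1]; simp
    · simp only [h1, h2, and_false]; simp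

/-- The probability of error of a decoder on the binary symmetric channel, for one codeword. -/
def bscError (p : ℝ) {m N : ℕ} (x : Fin m → ZMod 2) (dec : (Fin m → ZMod 2) → Fin N)
    (w : Fin N) : ℝ :=
  ∑ z : Fin m → ZMod 2, (∏ i, bern p (z i)) * (if dec (x + z) ≠ w then 1 else 0)

/-- The direct part of the coding theorem for the binary symmetric channel with a weight
constraint on every codeword. -/
theorem bsc_achievability {p q1 R : ℝ} (hp : p ∈ Set.Icc (0 : ℝ) 1) (hq0 : 0 ≤ q1)
    (hq1 : q1 ≤ 1 / 2) (hR0 : 0 ≤ R) (hR : R < gain p q1) {ε : ℝ} (hε : 0 < ε) :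
    ∀ᶠ m : ℕ in atTop, ∃ (N : ℕ) (c : Fin N → Fin m → ZMod 2) (dec : (Fin m → ZMod 2) → Fin N),
      (2 : ℝ) ^ ((m : ℝ) * R) ≤ N ∧ (∀ w, ∑ i, ((c w i).val : ℝ) ≤ m * q1) ∧
      ∀ w, bscError p (c w) dec w ≤ ε := by
  classical
  have hq1pos : 0 < q1 := by
    refine lt_of_le_of_ne hq0 fun he => ?_
    rw [← he, gain_zero] at hR
    linarith
  -- The inputs are drawn with bias slightly below q₁, which leaves room for weight fluctuations
  -- without losing the rate.
  obtain ⟨q, hqlt, hq0', hgq⟩ : ∃ q, q < q1 ∧ 0 < q ∧ R < gain p q := by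
    have h1 : ∀ᶠ q in 𝓝[<] q1, R < gain p q :=
      ((continuous_gain p).continuousAt.eventually (lt_mem_nhds hR)).filter_mono nhdsWithin_le_nhds
    have h2 : ∀ᶠ q in 𝓝[<] q1, 0 < q := (lt_mem_nhds hq1pos).filter_mono nhdsWithin_le_nhds
    obtain ⟨q, ⟨ha, hb⟩, hc⟩ := ((h1.and h2).and self_mem_nhdsWithin).exists
    exact ⟨q, hc, hb, ha⟩
  obtain ⟨γ, hRγ, hγ⟩ := exists_between hgq
  have hq : q ∈ Set.Ioo (0 : ℝ) 1 := ⟨hq0', by linarith⟩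
  have hq' : q ∈ Set.Icc (0 : ℝ) 1 := ⟨hq.1.le, hq.2.le⟩
  -- Feinstein's lemma needs an error level below 1.
  set ε' := min ε (1 / 2) with hε'
  have hε'0 : 0 < ε' := by positivity
  have hε'1 : ε' < 1 := (min_le_right _ _).trans_lt (by norm_num)
  set V1 := varOf (fun a : ZMod 2 × ZMod 2 => bern q a.1 * bern p (a.2 + a.1))
    (fun a => a.1.val)
  set V2 := varOf (fun a : ZMod 2 × ZMod 2 => bern q a.1 * bern p (a.2 + a.1))
        (fun a => logb 2 (bern p (a.2 + a.1) / bern (conv p q) a.2))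
  have hexp : Tendsto (fun m : ℕ => 2 * (2 : ℝ) ^ ((m : ℝ) * (R - γ))) atTop (𝓝 0) := by
    have h1 : Tendsto (fun m : ℕ => ((2 : ℝ) ^ (R - γ)) ^ m) atTop (𝓝 0) :=
      tendsto_pow_atTop_nhds_zero_of_lt_one (by positivity)
        (rpow_lt_one_of_one_lt_of_neg one_lt_two (by linarith))
    have h2 := h1.const_mul 2
    rw [mul_zero] at h2
    refine h2.congr fun m => ?_
    rw [← rpow_natCast, ← rpow_mul (by norm_num), mul_comm (R - γ)]
  have htend := (hexp.add (tendsto_chebyshev_bound V1 (q1 - q))).add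
    (tendsto_chebyshev_bound V2 (gain p q - γ))
  simp only [add_zero] at htend
  filter_upwards [htend.eventually (gt_mem_nhds hε'0), eventually_gt_atTop 0] with m hm hm0
  have hmass := bsc_typical_mass hp hq hqlt hγ hm0
  have hrpos : (0 : ℝ) < 2 ^ ((m : ℝ) * R) := by positivity
  have hr1 : (1 : ℝ) ≤ 2 ^ ((m : ℝ) * R) := one_le_rpow one_le_two (by positivity)
  have hθ : (0 : ℝ) < 2 ^ ((m : ℝ) * γ) := by positivity
  have hNθ : (⌈(2 : ℝ) ^ ((m : ℝ) * R)⌉₊ : ℝ) / 2 ^ ((m : ℝ) * γ) ≤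
      2 * (2 : ℝ) ^ ((m : ℝ) * (R - γ)) := by
    rw [mul_sub, rpow_sub two_pos, ← mul_div_assoc]
    gcongr
    linarith [Nat.ceil_lt_add_one hrpos.le]
  obtain ⟨c, dec, hc, herr⟩ := feinstein (fun x : Fin m → ZMod 2 => ∏ i, bern q (x i))
    (fun x y : Fin m → ZMod 2 => ∏ i, bern p (y i + x i)) (BscTypical p q q1 γ) (ε := ε')
    (N := ⌈(2 : ℝ) ^ ((m : ℝ) * R)⌉₊)
    (fun x => Finset.prod_nonneg fun i _ => bern_nonneg hq' _)
    (sum_prod_one fun _ => sum_bern q)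
    (fun x y => Finset.prod_nonneg fun i _ => bern_nonneg hp _)
    (fun x => sum_prod_one (f := fun i a => bern p (a + x i)) fun i => by
      rcases bit_cases (x i) with hx | hx <;> simp [hx, sum_bit])
    hθ hε'1
    (fun x y hT => by
      refine le_trans (le_of_eq ?_) hT.2
      congr 1
      simp_rw [← Finset.prod_mul_distrib]
      rw [sum_prod_apply (fun i a => bern q a * bern p (y i + a))]
      simp_rw [conv_bern])
    (Nat.ceil_pos.2 hrpos) (by linarith)
  refine ⟨_, c, dec, Nat.le_ceil _, fun w => ?_, fun w => ?_⟩
  · obtain ⟨y, hy⟩ := hc w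
    exact hy.1
  · refine le_trans (le_of_eq ?_) ((herr w).trans (min_le_left _ _))
    refine Fintype.sum_equiv (Equiv.addLeft (c w)) _ _ fun z => ?_
    simp only [Equiv.coe_addLeft, Pi.add_apply]
    congr 2
    ext i
    rw [add_comm (c w i), add_assoc, bit_add_self, add_zero]

/-! ### The error probability over the binary channel -/

/-- The output is a deterministic function of inputs, states and noise, so the sum over outputs can
be taken over noise words. -/
lemma sum_binaryMAC {n : ℕ} (p : ℝ) (x1 x2 s : Fin n → ZMod 2)
    (F : (Fin n → ZMod 2 × ZMod 2) → ℝ) :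
    ∑ y : Fin n → ZMod 2 × ZMod 2,
      (∏ i, bern (1 / 2) (s i) * binaryMAC p (x1 i) (x2 i) (s i) (y i)) * F y =
    ∑ z : Fin n → ZMod 2, (∏ i, bern (1 / 2) (s i)) * (∏ i, bern p (z i)) *
      F (fun i => (x1 i + s i + z i, x2 i)) := by
  classical
  have h1 : ∀ y : Fin n → ZMod 2 × ZMod 2,
      ∏ i, binaryMAC p (x1 i) (x2 i) (s i) (y i) =
        ∑ z : Fin n → ZMod 2, (∏ i, bern p (z i)) *
          (if y = (fun i => (x1 i + s i + z i, x2 i)) then 1 else 0) := by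
    intro y
    simp only [binaryMAC]
    rw [← sum_prod_apply]
    refine Finset.sum_congr rfl fun z _ => ?_
    rw [Finset.prod_mul_distrib, Finset.prod_ite_zero]
    simp [funext_iff]
  simp_rw [Finset.prod_mul_distrib, h1, Finset.mul_sum, Finset.sum_mul]
  rw [Finset.sum_comm]
  refine Finset.sum_congr rfl fun z _ => ?_
  rw [Finset.sum_eq_single (fun i => (x1 i + s i + z i, x2 i))]
  · simp
  · intro y _ hy
    simp [hy]
  · simp

lemma errorProb_binary {M n : ℕ} (p : ℝ)
    (c : Code (ZMod 2) (ZMod 2) (ZMod 2) (ZMod 2 × ZMod 2) 1 M n) :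
    c.errorProb (bern (1 / 2)) (binaryMAC p) =
      1 / (M : ℝ) * ∑ w : Fin M, ∑ s : Fin n → ZMod 2, ∑ z : Fin n → ZMod 2,
        (∏ i, bern (1 / 2) (s i)) * (∏ i, bern p (z i)) *
        (if (c.dec (fun i => (c.enc1 0 w s i + s i + z i, c.word2 0 s i))).2 ≠ w
          then 1 else 0) := by
  simp only [Code.errorProb, Nat.cast_one, one_mul, Finset.univ_unique, Finset.sum_singleton,
    Fin.default_eq_zero]
  congr 1
  refine Finset.sum_congr rfl fun w _ => Finset.sum_congr rfl fun s _ => ?_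
  rw [sum_binaryMAC p (c.enc1 0 w s) (c.word2 0 s) s
    (fun y => if c.dec y ≠ (0, w) then (1 : ℝ) else 0)]
  refine Finset.sum_congr rfl fun z _ => ?_
  congr 1
  refine if_congr (not_congr ?_) rfl rfl
  rw [Prod.ext_iff]
  exact ⟨fun h => h.2, fun h => ⟨Subsingleton.elim _ _, h⟩⟩

lemma sum_prod_castAdd {A : Type*} [Fintype A] (P : A → ℝ) (hP : ∑ a, P a = 1) (m k : ℕ)
    (f : (Fin m → A) → ℝ) :
    ∑ x : Fin (m + k) → A, (∏ i, P (x i)) * f (fun j => x (Fin.castAdd k j)) =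
      ∑ x : Fin m → A, (∏ i, P (x i)) * f x := by
  rw [← (Fin.appendEquiv m k).sum_comp, Fintype.sum_prod_type]
  refine Finset.sum_congr rfl fun x _ => ?_
  simp only [Fin.appendEquiv, Equiv.coe_fn_mk, Fin.prod_univ_add, Fin.append_left,
    Fin.append_right]
  have : ∀ y : Fin k → A, (∏ i, P (x i)) * (∏ i, P (y i)) * f x =
      ((∏ i, P (x i)) * f x) * ∏ i, P (y i) := by intro y; ring
  simp_rw [this]
  rw [← Finset.mul_sum, sum_prod_one (f := fun _ => P) (fun _ => hP), mul_one]

/-! ### Relaying the past states under a weight budget -/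

/-- The two bounds are proved together: as long as the budget covers the states seen, what has been
sent is at most their weight; afterwards nothing more is sent. -/
lemma budget_sum_le (a : ℕ → ℝ) (ha : ∀ j, 0 ≤ a j) {B : ℝ} (hB : 0 ≤ B) (k : ℕ) :
    (∑ i ∈ range (k + 1), if 0 < i ∧ ∑ j ∈ range i, a j ≤ B then a (i - 1) else 0) ≤
      ∑ j ∈ range k, a j ∧
    (∑ i ∈ range (k + 1), if 0 < i ∧ ∑ j ∈ range i, a j ≤ B then a (i - 1) else 0) ≤ B := by
  induction k with
  | zero => simpa using hB
  | succ k ih =>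
    rw [Finset.sum_range_succ]
    by_cases h : ∑ j ∈ range (k + 1), a j ≤ B
    · rw [if_pos ⟨Nat.succ_pos k, h⟩, Nat.add_sub_cancel]
      rw [Finset.sum_range_succ a] at h ⊢
      exact ⟨by linarith [ih.1], by linarith [ih.1]⟩
    · rw [if_neg (fun h' => h h'.2), add_zero, Finset.sum_range_succ a]
      exact ⟨by linarith [ih.1, ha k], ih.2⟩

/-- Encoder 2 repeats the previous state as long as the states seen so far fit the budget. -/
def relay (B : ℝ) (i : ℕ) (t : Fin i → ZMod 2) : ZMod 2 :=
  if h : 0 < i ∧ ∑ j, ((t j).val : ℝ) ≤ B then t ⟨i - 1, Nat.sub_lt h.1 one_pos⟩ else 0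

lemma relay_weight_le {n : ℕ} {B : ℝ} (hB : 0 ≤ B) (s : Fin n → ZMod 2) :
    ∑ i : Fin n, ((relay B i (fun j => s (Fin.castLE i.isLt.le j))).val : ℝ) ≤ B := by
  rcases n with _ | n
  · simpa using hB
  set a : ℕ → ℝ := fun j => if h : j < n + 1 then ((s ⟨j, h⟩).val : ℝ) else 0 with ha
  have ha0 : ∀ j, 0 ≤ a j := by
    intro j
    simp only [ha]
    split_ifs
    · exact bit_val_nonneg _
    · exact le_rfl
  have hsum : ∀ i : Fin (n + 1),
      ∑ j : Fin (i : ℕ), ((s (Fin.castLE i.isLt.le j)).val : ℝ) = ∑ j ∈ range i, a j := by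
    intro i
    rw [← Fin.sum_univ_eq_sum_range]
    refine Finset.sum_congr rfl fun j _ => ?_
    simp only [ha]
    rw [dif_pos (j.isLt.trans i.isLt)]
    rfl
  refine le_trans (le_of_eq ?_) (budget_sum_le a ha0 hB n).2
  rw [← Fin.sum_univ_eq_sum_range
    (fun i => if 0 < i ∧ ∑ j ∈ range i, a j ≤ B then a (i - 1) else 0)]
  refine Finset.sum_congr rfl fun i _ => ?_
  simp only [relay, hsum]
  split_ifs with h
  · simp only [ha]
    rw [dif_pos (lt_of_le_of_lt (Nat.sub_le _ _) i.isLt)]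
    rfl
  · exact bit_val_zero

lemma relay_eq {n m : ℕ} {B : ℝ} (s : Fin n → ZMod 2) (hmn : m < n)
    (hs : ∑ j : Fin m, ((s (Fin.castLE hmn.le j)).val : ℝ) ≤ B) (j : Fin m) :
    relay B (j + 1) (fun l => s (Fin.castLE (by omega) l)) = s (Fin.castLE hmn.le j) := by
  have : ∑ l : Fin ((j : ℕ) + 1), ((s (Fin.castLE (by omega) l)).val : ℝ) ≤ B := by
    refine le_trans ?_ hs
    have hinj := Fin.castLE_injective (Nat.succ_le_of_lt j.isLt)
    have hmap := Finset.sum_map univ ⟨_, hinj⟩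
      (fun j : Fin m => ((s (Fin.castLE hmn.le j)).val : ℝ))
    refine le_trans (le_of_eq hmap.symm) ?_
    exact Finset.sum_le_sum_of_subset_of_nonneg (subset_univ _) fun _ _ _ => bit_val_nonneg _
  rw [relay, dif_pos ⟨Nat.succ_pos _, this⟩]
  rfl

/-- The block code that uses a code for the binary symmetric channel on the first `m` positions,
where the decoder removes the states reported by Encoder 2. -/
def relayCode {m k N : ℕ} (hk : 0 < k) (B : ℝ) (cw : Fin N → Fin m → ZMod 2)
    (dec : (Fin m → ZMod 2) → Fin N) :
    Code (ZMod 2) (ZMod 2) (ZMod 2) (ZMod 2 × ZMod 2) 1 N (m + k) where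
  enc1 _ w _ i := if h : (i : ℕ) < m then cw w ⟨i, h⟩ else 0
  enc2 i _ t := relay B i t
  -- The state of position j appears in `Y₂` at position j + 1, which exists even for the last code
  -- position because k > 0.
  dec y := (0, dec fun j => (y (Fin.castAdd k j)).1 + (y ⟨j + 1, by omega⟩).2)

/-- Unless the first m states exceed the budget, the relayed states are exact and cancel, leaving
codeword plus noise. The union bound adds the two failures. -/
lemma relayCode_error {m k N : ℕ} (hk : 0 < k) (B : ℝ) (cw : Fin N → Fin m → ZMod 2)
    (dec : (Fin m → ZMod 2) → Fin N) {p ε₁ : ℝ} (hp : p ∈ Set.Icc (0 : ℝ) 1)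
    (hε : 0 ≤ ε₁) (hcode : ∀ w, bscError p (cw w) dec w ≤ ε₁) :
    (relayCode hk B cw dec).errorProb (bern (1 / 2)) (binaryMAC p) ≤
      ∑ s : Fin m → ZMod 2, (∏ i, bern (1 / 2) (s i)) *
        (if B < ∑ j, ((s j).val : ℝ) then 1 else 0) + ε₁ := by
  have hhalf : (1 / 2 : ℝ) ∈ Set.Icc (0 : ℝ) 1 := ⟨by norm_num, by norm_num⟩
  set A := ∑ s : Fin m → ZMod 2, (∏ i, bern (1 / 2) (s i)) *
        (if B < ∑ j, ((s j).val : ℝ) then 1 else 0) with hA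
  have hA0 : 0 ≤ A := Finset.sum_nonneg fun s _ => mul_nonneg
    (Finset.prod_nonneg fun i _ => bern_nonneg hhalf _) (by split_ifs <;> norm_num)
  rw [errorProb_binary]
  have hw : ∀ w : Fin N, ∑ s : Fin (m + k) → ZMod 2, ∑ z : Fin (m + k) → ZMod 2,
        (∏ i, bern (1 / 2) (s i)) * (∏ i, bern p (z i)) *
        (if ((relayCode hk B cw dec).dec (fun i =>
          ((relayCode hk B cw dec).enc1 0 w s i + s i + z i, (relayCode hk B cw dec).word2 0 s i))).2 ≠ w then 1 else 0) ≤ A + ε₁ := by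
    intro w
    have hpt : ∀ s z : Fin (m + k) → ZMod 2,
        (if ((relayCode hk B cw dec).dec (fun i =>
          ((relayCode hk B cw dec).enc1 0 w s i + s i + z i, (relayCode hk B cw dec).word2 0 s i))).2 ≠ w then (1 : ℝ) else 0) ≤
        (if B < ∑ j, ((s (Fin.castAdd k j)).val : ℝ) then 1 else 0) +
          (if dec (cw w + fun j => z (Fin.castAdd k j)) ≠ w then 1 else 0) := by
      intro s z
      by_cases hs : B < ∑ j, ((s (Fin.castAdd k j)).val : ℝ)
      · rw [if_pos hs]
        split_ifs <;> norm_num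
      · rw [if_neg hs, zero_add]
        apply le_of_eq
        refine if_congr (not_congr ?_) rfl rfl
        have harg : (fun j : Fin m => (relayCode hk B cw dec).enc1 0 w s (Fin.castAdd k j) +
            s (Fin.castAdd k j) + z (Fin.castAdd k j) +
            (relayCode hk B cw dec).word2 0 s ⟨j + 1, by omega⟩) =
            cw w + fun j => z (Fin.castAdd k j) := by
          funext j
          have h1 : (relayCode hk B cw dec).word2 0 s ⟨j + 1, by omega⟩ = s (Fin.castAdd k j) :=
            relay_eq s (by omega : m < m + k) (not_lt.1 hs) j
          have h2 : (relayCode hk B cw dec).enc1 0 w s (Fin.castAdd k j) = cw w j := by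
            simp [relayCode]
          rw [h1, h2, Pi.add_apply]
          have := bit_add_self (s (Fin.castAdd k j))
          linear_combination this
        change dec _ = w ↔ _
        rw [← harg]
    calc _ ≤ ∑ s : Fin (m + k) → ZMod 2, ∑ z : Fin (m + k) → ZMod 2,
        (∏ i, bern (1 / 2) (s i)) * (∏ i, bern p (z i)) *
          ((if B < ∑ j, ((s (Fin.castAdd k j)).val : ℝ) then 1 else 0) +
          (if dec (cw w + fun j => z (Fin.castAdd k j)) ≠ w then 1 else 0)) := by
          refine Finset.sum_le_sum fun s _ => Finset.sum_le_sum fun z _ =>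
            mul_le_mul_of_nonneg_left (hpt s z) ?_
          exact mul_nonneg (Finset.prod_nonneg fun i _ => bern_nonneg hhalf _)
            (Finset.prod_nonneg fun i _ => bern_nonneg hp _)
      _ = (∑ s : Fin (m + k) → ZMod 2, (∏ i, bern (1 / 2) (s i)) *
            (if B < ∑ j, ((s (Fin.castAdd k j)).val : ℝ) then 1 else 0)) *
            (∑ z : Fin (m + k) → ZMod 2, ∏ i, bern p (z i)) +
          (∑ s : Fin (m + k) → ZMod 2, ∏ i, bern (1 / 2) (s i)) *
            ∑ z : Fin (m + k) → ZMod 2, (∏ i, bern p (z i)) *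
              (if dec (cw w + fun j => z (Fin.castAdd k j)) ≠ w then 1 else 0) := by
          rw [Finset.sum_mul_sum, Finset.sum_mul_sum, ← Finset.sum_add_distrib]
          refine Finset.sum_congr rfl fun s _ => ?_
          rw [← Finset.sum_add_distrib]
          refine Finset.sum_congr rfl fun z _ => ?_
          ring
      _ = A + bscError p (cw w) dec w := by
          rw [sum_prod_one (f := fun _ => bern p) (fun _ => sum_bern p),
            sum_prod_one (f := fun _ => bern (1 / 2)) (fun _ => sum_bern _), mul_one, one_mul,
            sum_prod_castAdd (bern (1 / 2)) (sum_bern _) m k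
              (fun s => if B < ∑ j, ((s j).val : ℝ) then 1 else 0),
            sum_prod_castAdd (bern p) (sum_bern _) m k
              (fun z => if dec (cw w + z) ≠ w then 1 else 0)]
          rfl
      _ ≤ A + ε₁ := by linarith [hcode w]
  rcases Nat.eq_zero_or_pos N with rfl | hN
  · simpa using add_nonneg hA0 hε
  · have hN' : (0 : ℝ) < N := by exact_mod_cast hN
    rw [div_mul_eq_mul_div, one_mul, div_le_iff₀ hN']
    refine le_trans (Finset.sum_le_sum fun w _ => hw w) (le_of_eq ?_)
    rw [Finset.sum_const, Finset.card_univ, Fintype.card_fin, nsmul_eq_mul, mul_comm]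

lemma relayCode_meets {m k N : ℕ} (hk : 0 < k) {q1 q2 : ℝ} (hq1 : 0 ≤ q1) (hq2 : 0 ≤ q2)
    (cw : Fin N → Fin m → ZMod 2) (dec : (Fin m → ZMod 2) → Fin N)
    (hcw : ∀ w, ∑ i, ((cw w i).val : ℝ) ≤ m * q1) :
    (relayCode hk (((m + k : ℕ) : ℝ) * q2) cw dec).MeetsConstraints q1 q2 := by
  refine ⟨fun _ w s => ?_, fun _ s => relay_weight_le (by positivity) s⟩
  rw [Fin.sum_univ_add]
  have h1 : ∑ i : Fin k, (((relayCode hk (((m + k : ℕ) : ℝ) * q2) cw dec).enc1 0 w s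
      (Fin.natAdd m i)).val : ℝ) = 0 := by
    refine Finset.sum_eq_zero fun i _ => ?_
    simp [relayCode]
  have h2 : ∑ i : Fin m, (((relayCode hk (((m + k : ℕ) : ℝ) * q2) cw dec).enc1 0 w s
      (Fin.castAdd k i)).val : ℝ) = ∑ i, ((cw w i).val : ℝ) := by
    refine Finset.sum_congr rfl fun i _ => ?_
    simp [relayCode]
  have h3 : (m : ℝ) * q1 ≤ ((m + k : ℕ) : ℝ) * q1 := by
    push_cast
    nlinarith [(k.cast_nonneg : (0 : ℝ) ≤ k)]
  change (∑ i : Fin m, (((relayCode hk (((m + k : ℕ) : ℝ) * q2) cw dec).enc1 0 w s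
      (Fin.castAdd k i)).val : ℝ)) +
    (∑ i : Fin k, (((relayCode hk (((m + k : ℕ) : ℝ) * q2) cw dec).enc1 0 w s
      (Fin.natAdd m i)).val : ℝ)) ≤ _
  rw [h1, h2]
  linarith [hcw w]

/-- The idle tail has length proportional to the block: one position would serve the delay, but when
q₂ = 1/2 the relay also needs linear slack in its weight budget. -/
theorem achievable_of_lt_gain {p q1 q2 R : ℝ} (hp : p ∈ Set.Icc (0 : ℝ) 1) (hq0 : 0 ≤ q1)
    (hq1 : q1 ≤ 1 / 2) (hq2 : 1 / 2 ≤ q2) (hR0 : 0 ≤ R) (hR : R < gain p q1) :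
    Achievable p q1 q2 R := by
  intro ε hε
  obtain ⟨R', hRR', hR'⟩ := exists_between hR
  -- Of (L + 1)k positions, Lk carry the code; this L makes L R' ≥ (L + 1) R, so the dilution still
  -- leaves rate R.
  obtain ⟨L, hL⟩ := exists_nat_gt (R / (R' - R))
  have hLpos : (0 : ℝ) < L := lt_of_le_of_lt (div_nonneg hR0 (by linarith)) hL
  have hLR : ((L : ℝ) + 1) * R ≤ L * R' := by
    rw [div_lt_iff₀ (by linarith)] at hL
    linarith
  have hL0 : 0 < L := by exact_mod_cast hLpos
  have hmul : Tendsto (fun k : ℕ => L * k) atTop atTop := tendsto_id.const_mul_atTop' hL0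
  -- The budget, at least (Lk + k)/2, exceeds the mean state weight Lk/2 by at least k/2 = Lk ·
  -- 1/(2L).
  have hδ : (0 : ℝ) < 1 / (2 * L) := by positivity
  set V := ∑ a, bern (1 / 2) a * ((a.val : ℝ) - ∑ b, bern (1 / 2) b * (b.val : ℝ)) ^ 2 with hV
  have e1 := hmul.eventually
    (bsc_achievability hp hq0 hq1 (hR0.trans hRR'.le) hR' (half_pos hε))
  have e2 := hmul.eventually
    ((tendsto_chebyshev_bound V (1 / (2 * L))).eventually (gt_mem_nhds (half_pos hε)))
  obtain ⟨k, ⟨⟨N, cw, dec, hN, hcw, herr⟩, hcheb⟩, hk⟩ :=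
    ((e1.and e2).and (eventually_gt_atTop 0)).exists
  have hkR : (0 : ℝ) < k := by exact_mod_cast hk
  refine ⟨L * k + k, N, relayCode hk (((L * k + k : ℕ) : ℝ) * q2) cw dec, by omega, ?_,
    relayCode_meets hk hq0 (by linarith) cw dec hcw, ?_⟩
  · refine le_trans (rpow_le_rpow_of_exponent_le one_le_two ?_) hN
    push_cast
    nlinarith
  · refine (relayCode_error hk _ cw dec hp (half_pos hε).le herr).trans ?_
    have hmean : ∑ b : ZMod 2, bern (1 / 2) b * (b.val : ℝ) = 1 / 2 := by
      simp only [sum_bit, bit_val_one, bit_val_zero, bern_half]; norm_num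
    have hb := chebyshev_iid (bern (1 / 2)) (fun a => (a.val : ℝ))
      (bern_nonneg ⟨by norm_num, by norm_num⟩) (sum_bern _) (L * k) hδ (Nat.mul_pos hL0 hk)
      {s | ((L * k + k : ℕ) : ℝ) * q2 < ∑ j, ((s j).val : ℝ)} (by
        intro s hs _
        have hs' : ((L * k + k : ℕ) : ℝ) * q2 < ∑ j, ((s j).val : ℝ) := hs
        refine le_trans ?_ (le_abs_self _)
        rw [hmean]
        push_cast at hs' ⊢
        have h1 : (L : ℝ) * k * (1 / (2 * L)) = k / 2 := by field_simp
        rw [h1]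
        have h2 : ((L : ℝ) * k + k) * (1 / 2) ≤ ((L : ℝ) * k + k) * q2 := by gcongr
        linarith)
    simp only [Set.mem_ofPred_eq] at hb
    linarith

/-- The code with a single message and all inputs zero. -/
def trivialCode : Code (ZMod 2) (ZMod 2) (ZMod 2) (ZMod 2 × ZMod 2) 1 1 1 where
  enc1 _ _ _ _ := 0
  enc2 _ _ _ := 0
  dec _ := (0, 0)

lemma trivialCode_spec {p q1 q2 : ℝ} (hq1 : 0 ≤ q1) (hq2 : 0 ≤ q2) :
    trivialCode.MeetsConstraints q1 q2 ∧ trivialCode.Enc2IgnoresState ∧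
      trivialCode.errorProb (bern (1 / 2)) (binaryMAC p) = 0 := by
  refine ⟨⟨fun _ _ _ => ?_, fun _ _ => ?_⟩, fun _ _ _ _ => rfl, ?_⟩
  · simpa [trivialCode] using hq1
  · simpa [trivialCode, Code.word2] using hq2
  · rw [errorProb_binary]
    simp [Subsingleton.elim _ (0 : Fin 1)]

lemma achievableNoState_zero {p q1 q2 : ℝ} (hq1 : 0 ≤ q1) (hq2 : 0 ≤ q2) :
    AchievableNoState p q1 q2 0 := by
  intro ε hε
  obtain ⟨h1, h2, h3⟩ := trivialCode_spec (p := p) hq1 hq2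
  exact ⟨1, 1, trivialCode, one_pos, by simp, h1, h2, h3.trans_le hε.le⟩

lemma AchievableNoState.achievable {p q1 q2 R : ℝ} (hR : AchievableNoState p q1 q2 R) :
    Achievable p q1 q2 R := by
  intro ε hε
  obtain ⟨n, M, c, h1, h2, h3, _, h5⟩ := hR ε hε
  exact ⟨n, M, c, h1, h2, h3, h5⟩

/-! ### Divergence and Fano's inequality -/

/-- The Kullback-Leibler divergence in bits of two mass functions on a finite type. -/
def klBits {O : Type*} [Fintype O] (P Q : O → ℝ) : ℝ := ∑ o, P o * logb 2 (P o / Q o)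

/-- The log-sum inequality. -/
lemma log_sum_le {O : Type*} (E : Finset O) (a b : O → ℝ) (ha : ∀ o, 0 ≤ a o) (hb : ∀ o, 0 ≤ b o)
    (hab : ∀ o, b o = 0 → a o = 0) {B : ℝ} (hB : 0 < B) (hbB : ∑ o ∈ E, b o ≤ B) :
    (∑ o ∈ E, a o) * logb 2 ((∑ o ∈ E, a o) / B) ≤ ∑ o ∈ E, a o * logb 2 (a o / b o) := by
  set A := ∑ o ∈ E, a o with hA
  have hA0 : 0 ≤ A := Finset.sum_nonneg fun o _ => ha o
  rcases hA0.eq_or_lt with h0 | hApos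
  · rw [← h0, zero_mul]
    have hz := (Finset.sum_eq_zero_iff_of_nonneg fun o _ => ha o).1 (hA ▸ h0.symm)
    rw [Finset.sum_eq_zero]
    intro o ho
    rw [hz o ho, zero_mul]
  -- The bound log t ≥ 1 − 1/t at t = (a/b)/(A/B); the linear remainders sum to something
  -- nonnegative.
  have hterm : ∀ o ∈ E, a o * log (A / B) + (a o - b o * (A / B)) ≤ a o * log (a o / b o) := by
    intro o _
    rcases (ha o).eq_or_lt with h0 | hpos
    · rw [← h0]
      have := mul_nonneg (hb o) (div_pos hApos hB).le
      simp only [zero_mul]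
      linarith
    · have hbpos : 0 < b o := lt_of_le_of_ne (hb o) fun h => hpos.ne' (hab o h.symm)
      have h1 := one_sub_inv_le_log_of_pos (x := a o / b o / (A / B)) (by positivity)
      rw [log_div (by positivity) (by positivity)] at h1
      have h2 := mul_le_mul_of_nonneg_left h1 hpos.le
      have h3 : a o * (1 - (a o / b o / (A / B))⁻¹) = a o - b o * (A / B) := by
        field_simp
      rw [h3] at h2
      linarith
  have hsum := Finset.sum_le_sum hterm
  rw [Finset.sum_add_distrib, Finset.sum_sub_distrib, ← Finset.sum_mul, ← Finset.sum_mul,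
    ← hA] at hsum
  have h4 : (∑ o ∈ E, b o) * (A / B) ≤ A := by
    calc _ ≤ B * (A / B) := by gcongr
      _ = A := by field_simp
  have h5 : A * log (A / B) ≤ ∑ o ∈ E, a o * log (a o / b o) := by linarith
  simp only [logb, ← mul_div_assoc]
  rw [← Finset.sum_div]
  exact div_le_div_of_nonneg_right h5 log_two_pos.le

/-- Fano's inequality with the divergence to an arbitrary output distribution. -/
lemma fano {O : Type*} [Fintype O] {M : ℕ} (hM : 0 < M) (P : Fin M → O → ℝ) (Q : O → ℝ)
    (hP : ∀ w o, 0 ≤ P w o) (hP1 : ∀ w, ∑ o, P w o = 1) (hQ : ∀ o, 0 ≤ Q o) (hQ1 : ∑ o, Q o = 1)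
    (hPQ : ∀ w o, Q o = 0 → P w o = 0) {D : ℝ} (hD : ∀ w, klBits (P w) Q ≤ D) (dec : O → Fin M) :
    let ε := 1 / (M : ℝ) * ∑ w, ∑ o, P w o * (if dec o ≠ w then 1 else 0)
    0 ≤ ε ∧ (1 - ε) * logb 2 M ≤ D + h ε := by
  intro ε
  have hM' : (0 : ℝ) < M := by exact_mod_cast hM
  have hε0 : 0 ≤ ε := mul_nonneg (by positivity) (Finset.sum_nonneg fun w _ =>
    Finset.sum_nonneg fun o _ => mul_nonneg (hP w o) (by split_ifs <;> norm_num))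
  refine ⟨hε0, ?_⟩
  -- Joint laws of message and output: under `a` the output follows the message, under `b` it is
  -- independent of it. The log-sum inequality is applied to the error event and to its complement.
  set a : Fin M × O → ℝ := fun e => 1 / M * P e.1 e.2
  set b : Fin M × O → ℝ := fun e => 1 / M * Q e.2
  have ha : ∀ e, 0 ≤ a e := fun e => mul_nonneg (by positivity) (hP _ _)
  have hb : ∀ e, 0 ≤ b e := fun e => mul_nonneg (by positivity) (hQ _)
  have hab : ∀ e, b e = 0 → a e = 0 := by
    intro e he
    rcases mul_eq_zero.1 he with h | h
    · exact absurd h (by positivity)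
    · simp only [a, hPQ _ _ h, mul_zero]
  set E : Finset (Fin M × O) := univ.filter fun e => dec e.2 ≠ e.1
  set E' : Finset (Fin M × O) := univ.filter fun e => ¬ dec e.2 ≠ e.1
  have haE : ∑ e ∈ E, a e = ε := by
    simp only [E, a]
    rw [Finset.sum_filter, Fintype.sum_prod_type]
    simp only [ε, Finset.mul_sum]
    refine Finset.sum_congr rfl fun w _ => Finset.sum_congr rfl fun o _ => ?_
    split_ifs <;> simp
  have hatot : ∑ e, a e = 1 := by
    rw [Fintype.sum_prod_type]
    simp only [a, ← Finset.mul_sum, hP1]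
    simp [hM'.ne']
  have hbtot : ∑ e, b e = 1 := by
    rw [Fintype.sum_prod_type]
    simp only [b, ← Finset.mul_sum, hQ1]
    simp [hM'.ne']
  have hsplit : ∀ f : Fin M × O → ℝ, ∑ e ∈ E, f e + ∑ e ∈ E', f e = ∑ e, f e := fun f =>
    Finset.sum_filter_add_sum_filter_not _ _ _
  have haE' : ∑ e ∈ E', a e = 1 - ε := by linarith [hsplit a]
  have hbE : ∑ e ∈ E, b e ≤ 1 :=
    (Finset.sum_le_sum_of_subset_of_nonneg (subset_univ _) fun e _ _ => hb e).trans hbtot.le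
  -- An output independent of the message cannot beat guessing.
  have hbE' : ∑ e ∈ E', b e ≤ 1 / M := by
    simp only [E', b, not_not]
    rw [Finset.sum_filter, Fintype.sum_prod_type_right]
    simp [← Finset.mul_sum, hQ1]
  have l1 := log_sum_le E a b ha hb hab one_pos hbE
  have l2 := log_sum_le E' a b ha hb hab (by positivity) hbE'
  have l3 := hsplit fun e => a e * logb 2 (a e / b e)
  have l4 : ∑ e, a e * logb 2 (a e / b e) ≤ D := by
    have : ∑ e, a e * logb 2 (a e / b e) = ∑ w, 1 / M * klBits (P w) Q := by
      rw [Fintype.sum_prod_type]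
      simp only [klBits, Finset.mul_sum]
      refine Finset.sum_congr rfl fun w _ => Finset.sum_congr rfl fun o _ => ?_
      simp only [a, b]
      rw [mul_div_mul_left _ _ (by positivity), mul_assoc]
    rw [this]
    calc _ ≤ ∑ w : Fin M, 1 / (M : ℝ) * D :=
          Finset.sum_le_sum fun w _ => mul_le_mul_of_nonneg_left (hD w) (by positivity)
      _ = D := by simp [hM'.ne']
  rw [haE, div_one] at l1
  rw [haE', one_div, div_inv_eq_mul] at l2
  have l5 : (1 - ε) * logb 2 ((1 - ε) * M) = (1 - ε) * logb 2 (1 - ε) + (1 - ε) * logb 2 M := by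
    by_cases h1 : 1 - ε = 0
    · simp [h1]
    · rw [logb_mul h1 hM'.ne']; ring
  rw [l5] at l2
  simp only [h]
  linarith

/-! ### Divergence over the binary symmetric channel and the converse with states -/

lemma klBits_prod {n : ℕ} (P Q : Fin n → ZMod 2 → ℝ) (hP1 : ∀ i, ∑ a, P i a = 1)
    (hPQ : ∀ i a, Q i a = 0 → P i a = 0) :
    klBits (fun v : Fin n → ZMod 2 => ∏ i, P i (v i)) (fun v => ∏ i, Q i (v i)) =
      ∑ i, klBits (P i) (Q i) := by
  simp only [klBits]
  calc _ = ∑ v : Fin n → ZMod 2, ∑ i, (∏ j, P j (v j)) * logb 2 (P i (v i) / Q i (v i)) := by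
        refine Finset.sum_congr rfl fun v _ => ?_
        by_cases h0 : ∏ j, P j (v j) = 0
        · simp [h0]
        · have hne : ∀ i, P i (v i) ≠ 0 := fun i => Finset.prod_ne_zero_iff.1 h0 i (mem_univ i)
          rw [← Finset.mul_sum, ← logb_prod _ _ fun i _ =>
            div_ne_zero (hne i) fun h => hne i (hPQ i _ h), Finset.prod_div_distrib]
    _ = _ := by
        rw [Finset.sum_comm]
        exact Finset.sum_congr rfl fun i _ => sum_prod_mul_apply hP1 i
          (fun a => logb 2 (P i a / Q i a))

/-- For a word within the weight budget, the divergence of the output of the binary symmetric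
channel from the output induced by `Bern(q₁)` inputs is at most `n` times the gain. -/
lemma bsc_divergence {p q1 : ℝ} (hp : p ∈ Set.Icc (0 : ℝ) 1) (hq0 : 0 ≤ q1) (hq1 : q1 ≤ 1 / 2)
    {n : ℕ} (x : Fin n → ZMod 2) (hx : ∑ i, ((x i).val : ℝ) ≤ n * q1) :
    (∀ i a, bern (conv p q1) a = 0 → bern p (a + x i) = 0) ∧
    klBits (fun v : Fin n → ZMod 2 => ∏ i, bern p (v i + x i))
      (fun v => ∏ i, bern (conv p q1) (v i)) ≤ n * gain p q1 := by
  have hsum : ∀ i, ∑ a, bern p (a + x i) = 1 := fun i => by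
    rcases bit_cases (x i) with hx | hx <;> simp [hx, sum_bit]
  -- For q₁ = 0 the reference law may vanish somewhere, but then the word is zero and both laws
  -- coincide.
  rcases hq0.eq_or_lt with rfl | hqpos
  · have hx0 : ∀ i, x i = 0 := by
      intro i
      rw [mul_zero] at hx
      have := (Finset.sum_eq_zero_iff_of_nonneg fun i _ => bit_val_nonneg (x i)).1
        (le_antisymm hx (Finset.sum_nonneg fun i _ => bit_val_nonneg (x i))) i (mem_univ i)
      rcases bit_cases (x i) with h | h
      · exact h
      · rw [h, bit_val_one] at this
        exact absurd this one_ne_zero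
    have hac : ∀ i a, bern (conv p 0) a = 0 → bern p (a + x i) = 0 := by
      intro i a; simp [hx0]
    refine ⟨hac, ?_⟩
    simp only [klBits, hx0, add_zero, conv_zero, gain_zero, mul_zero]
    refine (Finset.sum_eq_zero fun v _ => ?_).le
    by_cases h0 : ∏ i, bern p (v i) = 0
    · simp [h0]
    · simp [div_self h0]
  · obtain ⟨hc0, hc1⟩ := conv_mem_Ioo hp ⟨hqpos, by linarith⟩
    have hac : ∀ i a, bern (conv p q1) a = 0 → bern p (a + x i) = 0 := by
      intro i a ha
      rcases bit_cases a with rfl | rfl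
      · simp at ha; linarith
      · simp at ha; linarith
    refine ⟨hac, ?_⟩
    rw [klBits_prod (fun i a => bern p (a + x i)) (fun _ => bern (conv p q1)) hsum hac]
    set d : ZMod 2 → ℝ := fun x => klBits (fun a => bern p (a + x)) (bern (conv p q1)) with hd
    -- The divergence per letter is affine in the bit, so the total depends only on the weight; its
    -- `Bern(q₁)` average is the gain, and a nonnegative slope makes the full budget the worst case.
    have hdlin : ∀ x, d x = d 0 + (d 1 - d 0) * (x.val : ℝ) := by
      intro x
      rcases bit_cases x with rfl | rfl
      · rw [bit_val_zero]; ring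
      · rw [bit_val_one]; ring
    have hgain : (1 - q1) * d 0 + q1 * d 1 = gain p q1 := by
      rw [← bsc_mean_density (p := p) (q := q1) hc0.ne' (by linarith), Fintype.sum_prod_type]
      simp only [hd, klBits, sum_bit, bern_apply_zero, bern_apply_one]
      ring
    -- Both factors of the slope have the sign of 1 − 2p, since `conv p q1` lies between p and 1/2.
    have hmono : 0 ≤ d 1 - d 0 := by
      have hne : ∀ y, bern (conv p q1) y ≠ 0 := by
        intro y; rcases bit_cases y with rfl | rfl
        · simp only [bern_apply_zero]; linarith
        · simp only [bern_apply_one]; linarith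
      have : d 1 - d 0 = (1 - 2 * p) * (logb 2 (1 - conv p q1) - logb 2 (conv p q1)) := by
        simp only [hd, klBits, mul_logb_div _ (hne _)]
        simp only [sum_bit, add_zero, zero_add, bit_one_add_one, bern_apply_zero, bern_apply_one]
        ring
      rw [this]
      rcases le_total p (1 / 2) with h2 | h2
      · refine mul_nonneg (by linarith) (sub_nonneg.2 (logb_le_logb_of_le one_lt_two hc0 ?_))
        unfold conv; nlinarith
      · refine mul_nonneg_of_nonpos_of_nonpos (by linarith)
          (sub_nonpos.2 (logb_le_logb_of_le one_lt_two (by linarith) ?_))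
        unfold conv; nlinarith
    change ∑ i, d (x i) ≤ _
    simp_rw [hdlin (x _)]
    rw [Finset.sum_add_distrib, ← Finset.mul_sum]
    simp only [Finset.sum_const, Finset.card_univ, Fintype.card_fin, nsmul_eq_mul]
    have := mul_le_mul_of_nonneg_left hx hmono
    rw [← hgain]
    linarith

/-- The passage from Fano's inequality to a bound on an achievable rate. -/
lemma rate_le_of_fano {R G : ℝ}
    (H : ∀ ε₀ : ℝ, 0 < ε₀ → ∃ (ε : ℝ) (n M : ℕ), 0 ≤ ε ∧ ε ≤ ε₀ ∧ 0 < n ∧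
      (2 : ℝ) ^ ((n : ℝ) * R) ≤ M ∧ (1 - ε) * logb 2 M ≤ n * G + h ε) : R ≤ G := by
  by_contra hlt
  push Not at hlt
  have hcont : ContinuousAt (fun ε => G + h ε - (1 - ε) * R) 0 := by
    have := continuous_h
    fun_prop
  have hneg : ∀ᶠ ε in 𝓝 (0 : ℝ), G + h ε - (1 - ε) * R < 0 :=
    hcont.eventually (gt_mem_nhds (by simpa using hlt))
  obtain ⟨δ, hδ, hball⟩ := Metric.eventually_nhds_iff.1 hneg
  obtain ⟨ε, n, M, h0, h1, hn, hM, hF⟩ := H (min (δ / 2) 1) (by positivity)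
  have hε1 : ε ≤ 1 := h1.trans (min_le_right _ _)
  have hn1 : (1 : ℝ) ≤ n := by exact_mod_cast hn
  have hlog : n * R ≤ logb 2 M := by
    rw [le_logb_iff_rpow_le one_lt_two (lt_of_lt_of_le (by positivity) hM)]
    exact hM
  have h3 : (1 - ε) * (n * R) ≤ (1 - ε) * logb 2 M :=
    mul_le_mul_of_nonneg_left hlog (by linarith)
  -- The block lengths need not grow, so the entropy term is scaled up to n h(ε) and vanishes
  -- through ε instead.
  have h4 : h ε ≤ n * h ε := le_mul_of_one_le_left (h_nonneg h0 hε1) hn1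
  have h5 : (n : ℝ) * ((1 - ε) * R) ≤ n * (G + h ε) := by linarith
  have h6 := le_of_mul_le_mul_left h5 (by linarith)
  have h7 := hball (y := ε) (by
    rw [dist_zero_right, norm_of_nonneg h0]
    have := h1.trans (min_le_left _ _)
    linarith)
  linarith

lemma prod_bern_half_pos {n : ℕ} (s : Fin n → ZMod 2) : 0 < ∏ i, bern (1 / 2) (s i) :=
  Finset.prod_pos fun i _ => by rw [bern_half]; norm_num

/-- The converse: a rate achievable with strictly causal states at Encoder 2 is at most the gain. -/
theorem le_gain_of_achievable {p q1 q2 R : ℝ} (hp : p ∈ Set.Icc (0 : ℝ) 1) (hq0 : 0 ≤ q1)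
    (hq1 : q1 ≤ 1 / 2) (hR : Achievable p q1 q2 R) : R ≤ gain p q1 := by
  refine rate_le_of_fano fun ε₀ hε₀ => ?_
  obtain ⟨n, M, c, hn, hM, ⟨hc, -⟩, herr⟩ := hR ε₀ hε₀
  have hMpos : 0 < M := by
    have : (0 : ℝ) < M := lt_of_lt_of_le (by positivity) hM
    exact_mod_cast this
  have hq1mem : q1 ∈ Set.Icc (0 : ℝ) 1 := ⟨hq0, by linarith⟩
  have hsum : ∀ (x : Fin n → ZMod 2), ∑ v : Fin n → ZMod 2, ∏ i, bern p (v i + x i) = 1 := by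
    intro x
    refine sum_prod_one (f := fun i a => bern p (a + x i)) fun i => ?_
    rcases bit_cases (x i) with hx | hx <;> simp [hx, sum_bit]
  have hhalf : ∑ s : Fin n → ZMod 2, ∏ i, bern (1 / 2) (s i) = 1 :=
    sum_prod_one (f := fun _ => bern (1 / 2)) fun _ => sum_bern _
  -- The decoder is given the states together with v = X₁ + Z₁; from these it rebuilds Y₁ = v + S
  -- and the word of Encoder 2, so the error probability is unchanged.
  obtain ⟨hε0, hF⟩ := fano (O := (Fin n → ZMod 2) × (Fin n → ZMod 2)) hMpos
    (fun w o => (∏ i, bern (1 / 2) (o.1 i)) * ∏ i, bern p (o.2 i + c.enc1 0 w o.1 i))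
    (fun o => (∏ i, bern (1 / 2) (o.1 i)) * ∏ i, bern (conv p q1) (o.2 i))
    (fun w o => mul_nonneg (prod_bern_half_pos _).le
      (Finset.prod_nonneg fun i _ => bern_nonneg hp _))
    (fun w => by
      rw [Fintype.sum_prod_type]
      simp only [← Finset.mul_sum, hsum, mul_one, hhalf])
    (fun o => mul_nonneg (prod_bern_half_pos _).le
      (Finset.prod_nonneg fun i _ => bern_nonneg (conv_mem hp hq1mem) _))
    (by
      rw [Fintype.sum_prod_type]
      simp only [← Finset.mul_sum]
      rw [sum_prod_one (f := fun _ => bern (conv p q1)) fun _ => sum_bern _]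
      simp only [mul_one, hhalf])
    (fun w o ho => by
      rcases mul_eq_zero.1 ho with h0 | h0
      · exact absurd h0 (prod_bern_half_pos _).ne'
      · obtain ⟨i, -, hi⟩ := Finset.prod_eq_zero_iff.1 h0
        exact mul_eq_zero_of_right _ (Finset.prod_eq_zero (mem_univ i)
          ((bsc_divergence hp hq0 hq1 (c.enc1 0 w o.1) (hc 0 w o.1)).1 i _ hi)))
    (D := n * gain p q1)
    (fun w => by
      rw [klBits, Fintype.sum_prod_type]
      calc _ = ∑ s : Fin n → ZMod 2, (∏ i, bern (1 / 2) (s i)) *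
            klBits (fun v : Fin n → ZMod 2 => ∏ i, bern p (v i + c.enc1 0 w s i))
              (fun v => ∏ i, bern (conv p q1) (v i)) := by
            refine Finset.sum_congr rfl fun s _ => ?_
            rw [klBits, Finset.mul_sum]
            refine Finset.sum_congr rfl fun v _ => ?_
            rw [mul_div_mul_left _ _ (prod_bern_half_pos s).ne', mul_assoc]
        _ ≤ ∑ s : Fin n → ZMod 2, (∏ i, bern (1 / 2) (s i)) * (n * gain p q1) :=
            Finset.sum_le_sum fun s _ => mul_le_mul_of_nonneg_left
              (bsc_divergence hp hq0 hq1 _ (hc 0 w s)).2 (prod_bern_half_pos s).le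
        _ = n * gain p q1 := by rw [← Finset.sum_mul, hhalf, one_mul])
    (fun o => (c.dec fun i => (o.2 i + o.1 i, c.word2 0 o.1 i)).2)
  have hεeq : 1 / (M : ℝ) * ∑ w, ∑ o : (Fin n → ZMod 2) × (Fin n → ZMod 2),
      ((∏ i, bern (1 / 2) (o.1 i)) * ∏ i, bern p (o.2 i + c.enc1 0 w o.1 i)) *
      (if (c.dec fun i => (o.2 i + o.1 i, c.word2 0 o.1 i)).2 ≠ w then 1 else 0) =
      c.errorProb (bern (1 / 2)) (binaryMAC p) := by
    rw [errorProb_binary]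
    congr 1
    refine Finset.sum_congr rfl fun w _ => ?_
    rw [Fintype.sum_prod_type]
    refine Finset.sum_congr rfl fun s _ => ?_
    refine Fintype.sum_equiv (Equiv.addRight (c.enc1 0 w s)) _ _ fun v => ?_
    simp only [Equiv.coe_addRight, Pi.add_apply]
    have hx : ∀ i, c.enc1 0 w s i + s i + (v i + c.enc1 0 w s i) = v i + s i := fun i => by
      linear_combination bit_add_self (c.enc1 0 w s i)
    simp only [hx]
  rw [hεeq] at hε0 hF
  exact ⟨_, n, M, hε0, herr, hn, hM, hF⟩

/-! ### Entropy sums on finite types -/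

/-- The function `-x log₂ x`. -/
def eta (x : ℝ) : ℝ := negMulLog x / log 2

lemma eta_eq (x : ℝ) : eta x = -(x * logb 2 x) := by
  simp only [eta, negMulLog, logb]; ring

@[simp] lemma eta_zero : eta 0 = 0 := by simp [eta]
@[simp] lemma eta_one : eta 1 = 0 := by simp [eta]

lemma continuous_eta : Continuous eta := by unfold eta; fun_prop

lemma eta_mul (x y : ℝ) : eta (x * y) = y * eta x + x * eta y := by
  simp only [eta, negMulLog_mul]; ring

lemma h_eq_eta (a : ℝ) : h a = eta a + eta (1 - a) := by
  simp only [h, eta_eq]; ring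

lemma sum_eta_bern (p : ℝ) : ∑ y, eta (bern p y) = h p := by
  rw [h_eq_eta]; simp [sum_bit]; ring

lemma sum_eta_mul {ι : Type*} [Fintype ι] (c : ℝ) (f : ι → ℝ) :
    ∑ i, eta (c * f i) = (∑ i, f i) * eta c + c * ∑ i, eta (f i) := by
  simp_rw [eta_mul, Finset.sum_add_distrib, ← Finset.sum_mul, ← Finset.mul_sum]

lemma mutualInfo_eq {A B : Type} [Fintype A] [Fintype B] {P : A → B → ℝ}
    (hP : ∀ a b, 0 ≤ P a b) :
    mutualInfo P = ∑ a, eta (∑ b, P a b) + ∑ b, eta (∑ a, P a b) - ∑ a, ∑ b, eta (P a b) := by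
  have h1 : ∀ a b, P a b * logb 2 (P a b / ((∑ b', P a b') * (∑ a', P a' b))) =
      -eta (P a b) - P a b * logb 2 (∑ b', P a b') - P a b * logb 2 (∑ a', P a' b) := by
    intro a b
    rcases (hP a b).eq_or_lt with h0 | hpos
    · simp [← h0]
    · have ha : 0 < ∑ b', P a b' := lt_of_lt_of_le hpos
        (Finset.single_le_sum (f := fun b' => P a b') (fun b' _ => hP a b') (mem_univ b))
      have hb : 0 < ∑ a', P a' b := lt_of_lt_of_le hpos
        (Finset.single_le_sum (f := fun a' => P a' b) (fun a' _ => hP a' b) (mem_univ a))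
      rw [logb_div hpos.ne' (mul_pos ha hb).ne', logb_mul ha.ne' hb.ne', eta_eq]
      ring
  simp only [mutualInfo, h1, Finset.sum_sub_distrib, Finset.sum_neg_distrib]
  rw [Finset.sum_comm (f := fun a b => P a b * logb 2 (∑ a', P a' b))]
  simp only [← Finset.sum_mul, eta_eq, Finset.sum_neg_distrib]
  ring

lemma mutualInfo_nonneg {A B : Type} [Fintype A] [Fintype B] {P : A → B → ℝ}
    (hP : ∀ a b, 0 ≤ P a b) (hP1 : ∑ a, ∑ b, P a b = 1) : 0 ≤ mutualInfo P := by
  have key := log_sum_le (univ : Finset (A × B)) (fun e => P e.1 e.2)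
    (fun e => (∑ b', P e.1 b') * (∑ a', P a' e.2)) (fun e => hP _ _)
    (fun e => mul_nonneg (Finset.sum_nonneg fun _ _ => hP _ _)
      (Finset.sum_nonneg fun _ _ => hP _ _))
    (fun e he => by
      rcases mul_eq_zero.1 he with h0 | h0
      · exact (Finset.sum_eq_zero_iff_of_nonneg fun b _ => hP e.1 b).1 h0 _ (mem_univ _)
      · exact (Finset.sum_eq_zero_iff_of_nonneg fun a _ => hP a e.2).1 h0 _ (mem_univ _))
    one_pos (by
      rw [Fintype.sum_prod_type]
      simp only
      rw [← Finset.sum_mul_sum, hP1, one_mul, Finset.sum_comm, hP1])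
  simp only [Fintype.sum_prod_type] at key
  rw [hP1] at key
  simpa [mutualInfo] using key

/-! ### The single-letter functional of a law on state and input -/

lemma binaryY1_eq (p : ℝ) (x s y : ZMod 2) : binaryY1 p x s y = bern p (y + x + s) := by
  have h1 : ∀ z : ZMod 2, (y = x + s + z) = (z = y + x + s) := by
    intro z
    revert x s y z
    decide
  simp only [binaryY1, h1]
  simp

lemma sum_bern_add (p : ℝ) (a : ZMod 2) : ∑ y, bern p (y + a) = 1 := by
  rw [← sum_bern p]
  exact Fintype.sum_equiv (Equiv.addRight a) _ _ fun _ => rfl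

/-- The marginal on the state. -/
def margS (m : ZMod 2 × ZMod 2 → ℝ) (s : ZMod 2) : ℝ := ∑ x, m (s, x)

/-- The marginal of the channel output `X + S + Z`. -/
def margY (p : ℝ) (m : ZMod 2 × ZMod 2 → ℝ) (y : ZMod 2) : ℝ :=
  ∑ s, ∑ x, m (s, x) * bern p (y + x + s)

/-- The entropy of the state minus the entropy of the output. -/
def entGap (p : ℝ) (m : ZMod 2 × ZMod 2 → ℝ) : ℝ :=
  ∑ s, eta (margS m s) - ∑ y, eta (margY p m y)

/-- The expected input weight. -/
def inputCost (m : ZMod 2 × ZMod 2 → ℝ) : ℝ := ∑ s, m (s, 1)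

lemma sum_margS (m : ZMod 2 × ZMod 2 → ℝ) : ∑ s, margS m s = ∑ e, m e := by
  rw [Fintype.sum_prod_type]; rfl

lemma sum_margY (p : ℝ) (m : ZMod 2 × ZMod 2 → ℝ) : ∑ y, margY p m y = ∑ e, m e := by
  rw [Fintype.sum_prod_type]
  simp only [margY]
  rw [Finset.sum_comm]
  refine Finset.sum_congr rfl fun s _ => ?_
  rw [Finset.sum_comm]
  refine Finset.sum_congr rfl fun x _ => ?_
  simp_rw [add_assoc]
  rw [← Finset.mul_sum, sum_bern_add, mul_one]

lemma margS_smul (c : ℝ) (m : ZMod 2 × ZMod 2 → ℝ) (s : ZMod 2) :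
    margS (c • m) s = c * margS m s := by
  simp [margS, Finset.mul_sum]

lemma margY_smul (p c : ℝ) (m : ZMod 2 × ZMod 2 → ℝ) (y : ZMod 2) :
    margY p (c • m) y = c * margY p m y := by
  simp [margY, Finset.mul_sum, mul_assoc]

/-- The terms containing `eta c` cancel because both marginals have the same total mass. Thus an
unnormalised law contributes its mass times the gap of the normalised one. -/
lemma entGap_smul (p c : ℝ) (m : ZMod 2 × ZMod 2 → ℝ) :
    entGap p (c • m) = c * entGap p m := by
  simp only [entGap, margS_smul, margY_smul, sum_eta_mul, sum_margS, sum_margY]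
  ring

lemma inputCost_smul (c : ℝ) (m : ZMod 2 × ZMod 2 → ℝ) :
    inputCost (c • m) = c * inputCost m := by
  simp [inputCost, Finset.mul_sum]

lemma inputCost_mem {m : ZMod 2 × ZMod 2 → ℝ} (hm : m ∈ stdSimplex ℝ (ZMod 2 × ZMod 2)) :
    inputCost m ∈ Set.Icc (0 : ℝ) 1 := by
  obtain ⟨h0, h1⟩ := hm
  rw [Fintype.sum_prod_type] at h1
  simp only [sum_bit, inputCost] at h1 ⊢
  constructor
  · linarith [h0 (0, 1), h0 (1, 1)]
  · linarith [h0 (0, 0), h0 (1, 0)]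

/-- A strictly concave function vanishing at 0 and 1 is positive in between. -/
lemma gain_pos {p q : ℝ} (hp0 : 0 ≤ p) (hp1 : p ≤ 1) (hp : p ≠ 1 / 2) (hq0 : 0 < q)
    (hq1 : q < 1) : 0 < gain p q := by
  have h1 : gain p 1 = 0 := by
    have : conv p 1 = 1 - p := by unfold conv; ring
    rw [gain, this, h_one_sub, sub_self]
  have := (gain_strictConcaveOn hp0 hp1 hp).2 (x := 0) (y := 1) ⟨le_rfl, zero_le_one⟩
    ⟨zero_le_one, le_rfl⟩ zero_ne_one (sub_pos.2 hq1) hq0 (by ring)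
  simpa [h1] using this

lemma gain_nonneg_of_mem {p q : ℝ} (hp0 : 0 ≤ p) (hp1 : p ≤ 1) (hp : p ≠ 1 / 2)
    (hq : q ∈ Set.Icc (0 : ℝ) 1) : 0 ≤ gain p q := by
  rcases hq.1.eq_or_lt with rfl | h0
  · simp
  · rcases hq.2.eq_or_lt with rfl | h1
    · have : conv p 1 = 1 - p := by unfold conv; ring
      rw [gain, this, h_one_sub, sub_self]
    · exact (gain_pos hp0 hp1 hp h0 h1).le

/-- The entropy of the output of a binary symmetric channel exceeds that of the noise, for an
unnormalised input law `(a, b)`. -/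
lemma sum_eta_channel {p a b : ℝ} (hp0 : 0 ≤ p) (hp1 : p ≤ 1) (hp : p ≠ 1 / 2) (ha : 0 ≤ a)
    (hb : 0 ≤ b) (s : ZMod 2) :
    eta (a + b) + (a + b) * h p ≤ ∑ y, eta (a * bern p (y + 0 + s) + b * bern p (y + 1 + s)) ∧
    (eta (a + b) + (a + b) * h p = ∑ y, eta (a * bern p (y + 0 + s) + b * bern p (y + 1 + s)) →
      a = 0 ∨ b = 0) := by
  have hshift : ∑ y, eta (a * bern p (y + 0 + s) + b * bern p (y + 1 + s)) =
      ∑ y, eta (a * bern p y + b * bern p (y + 1)) := by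
    refine Fintype.sum_equiv (Equiv.addRight s) _ _ fun y => ?_
    simp only [Equiv.coe_addRight, add_zero, add_right_comm]
  rw [hshift]
  rcases (add_nonneg ha hb).eq_or_lt with h0 | hpos
  · have ha0 : a = 0 := by linarith
    have hb0 : b = 0 := by linarith
    simp [ha0, hb0]
  -- Normalised input bias: the claim becomes `gain p t ≥ 0`, strict for 0 < t < 1.
  set t := b / (a + b) with ht
  have ht0 : 0 ≤ t := by positivity
  have ht1 : t ≤ 1 := by rw [ht, div_le_one hpos]; linarith
  have hbt : b = (a + b) * t := by rw [ht]; field_simp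
  have hat : a = (a + b) * (1 - t) := by linear_combination -hbt
  have hsum : ∑ y, eta (a * bern p y + b * bern p (y + 1)) =
      eta (a + b) + (a + b) * h (conv p t) := by
    have : ∀ y, a * bern p y + b * bern p (y + 1) = (a + b) * bern (conv p t) y := by
      intro y
      rw [← conv_bern, sum_bit]
      simp only [bern_apply_zero, bern_apply_one, add_zero]
      linear_combination bern p y * hat + bern p (y + 1) * hbt
    simp_rw [this]
    rw [sum_eta_mul, sum_bern, sum_eta_bern, one_mul]
  rw [hsum]
  have hg := gain_nonneg_of_mem hp0 hp1 hp ⟨ht0, ht1⟩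
  refine ⟨?_, fun he => ?_⟩
  · unfold gain at hg
    have := mul_le_mul_of_nonneg_left (sub_nonneg.1 hg) hpos.le
    linarith
  · by_contra hcon
    push Not at hcon
    have ht0' : 0 < t := div_pos (lt_of_le_of_ne hb (Ne.symm hcon.2)) hpos
    have ht1' : t < 1 := by
      rw [ht, div_lt_one hpos]
      linarith [lt_of_le_of_ne ha (Ne.symm hcon.1)]
    have hg' := gain_pos hp0 hp1 hp ht0' ht1'
    unfold gain at hg'
    have := mul_lt_mul_of_pos_left (sub_pos.1 hg') hpos
    linarith

/-- Both H(Y|S) ≥ h(p) and I(D;Y) ≥ 0 are used, with D = S + Y distributed as Bern(p ∗ cost).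
Equality makes X deterministic given S. Constant X has cost 0 or 1; the two remaining maps have gap
h(cost) − h(p), and h(cost) < h(p ∗ cost). -/
lemma entGap_le {p : ℝ} (hp0 : 0 < p) (hp1 : p < 1) (hp : p ≠ 1 / 2)
    {m : ZMod 2 × ZMod 2 → ℝ} (hm : m ∈ stdSimplex ℝ (ZMod 2 × ZMod 2)) :
    entGap p m ≤ gain p (inputCost m) ∧
      (0 < inputCost m → inputCost m < 1 / 2 → entGap p m < gain p (inputCost m)) := by
  obtain ⟨h0, h1⟩ := hm
  have hpI : p ∈ Set.Icc (0 : ℝ) 1 := ⟨hp0.le, hp1.le⟩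
  have h1' : m (0, 0) + m (0, 1) + (m (1, 0) + m (1, 1)) = 1 := by
    rw [Fintype.sum_prod_type] at h1
    simpa [sum_bit] using h1
  -- the joint law of the state and the output, and of the output and their sum
  set J : ZMod 2 → ZMod 2 → ℝ := fun s y =>
    m (s, 0) * bern p (y + 0 + s) + m (s, 1) * bern p (y + 1 + s) with hJ
  have hJ0 : ∀ s y, 0 ≤ J s y := fun s y =>
    add_nonneg (mul_nonneg (h0 _) (bern_nonneg hpI _)) (mul_nonneg (h0 _) (bern_nonneg hpI _))
  have hlow := fun s => sum_eta_channel hp0.le hp1.le hp (h0 (s, 0)) (h0 (s, 1)) s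
  -- Joint law of D and Y, a relabelling of that of S and Y.
  set K : ZMod 2 → ZMod 2 → ℝ := fun d y => J (d + y) y with hK
  have hKY : ∀ y, ∑ d, K d y = margY p m y := by
    intro y
    have : ∑ d, K d y = ∑ s, J s y := Fintype.sum_equiv (Equiv.addRight y) _ _ fun _ => rfl
    rw [this, margY]
    exact Finset.sum_congr rfl fun s _ => (sum_bit fun x => m (s, x) * bern p (y + x + s)).symm
  have hKD : ∀ d, ∑ y, K d y = bern (conv p (inputCost m)) d := by
    intro d
    rcases bit_cases d with rfl | rfl <;>
      simp [hK, hJ, sum_bit, inputCost, conv]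
    · linear_combination (1 - p) * h1'
    · linear_combination p * h1'
  have hKsum : ∑ d, ∑ y, eta (K d y) = ∑ s, ∑ y, eta (J s y) := by
    rw [Finset.sum_comm, Finset.sum_comm (f := fun s y => eta (J s y))]
    refine Finset.sum_congr rfl fun y _ => ?_
    exact Fintype.sum_equiv (Equiv.addRight y) _ _ fun _ => rfl
  have hMI := mutualInfo_nonneg (P := K) (fun d y => hJ0 _ _) (by
    rw [Finset.sum_congr rfl fun d _ => hKD d]; exact sum_bern _)
  rw [mutualInfo_eq (fun d y => hJ0 _ _), hKsum,
    Finset.sum_congr rfl fun d _ => congrArg eta (hKD d),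
    Finset.sum_congr rfl fun y _ => congrArg eta (hKY y), sum_eta_bern] at hMI
  have hS : ∑ s, eta (margS m s) =
      eta (m (0, 0) + m (0, 1)) + eta (m (1, 0) + m (1, 1)) := by
    simp [sum_bit, margS]
  have hl0 := hlow 0
  have hl1 := hlow 1
  rw [sum_bit (fun s => ∑ y, eta (J s y))] at hMI
  have hpsum : (m (0, 0) + m (0, 1)) * h p + (m (1, 0) + m (1, 1)) * h p = h p := by
    rw [← add_mul, h1', one_mul]
  have hle : entGap p m ≤ gain p (inputCost m) := by
    unfold entGap gain
    linarith [hl0.1, hl1.1]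
  refine ⟨hle, fun hc0 hc1 => lt_of_le_of_ne hle fun heq => ?_⟩
  unfold entGap gain at heq
  have e0 := hl0.2 (by linarith [hl0.1, hl1.1])
  have e1 := hl1.2 (by linarith [hl0.1, hl1.1])
  have hcost : inputCost m = m (0, 1) + m (1, 1) := sum_bit _
  -- Positivity of the gain with the roles of noise and input exchanged, for which cost ≠ 1/2 is
  -- essential.
  have hstrict : h (inputCost m) < h (conv p (inputCost m)) := by
    have := gain_pos hc0.le (by linarith) hc1.ne hp0 hp1
    rw [gain, conv_comm] at this
    linarith
  have hfin : ∀ b : ZMod 2, (∀ y, margY p m y = bern p (y + b)) →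
      ∑ s, eta (margS m s) = h (inputCost m) → False := by
    intro b hY hSS
    have : ∑ y, eta (margY p m y) = h p := by
      simp_rw [hY]
      rw [← sum_eta_bern p]
      exact Fintype.sum_equiv (Equiv.addRight b) _ _ fun _ => rfl
    linarith
  rcases e0 with e0 | e0 <;> rcases e1 with e1 | e1
  · linarith
  · have hm1 : m (1, 0) = 1 - m (0, 1) := by linarith
    refine hfin 1 (fun y => ?_) ?_
    · simp only [margY, sum_bit, e0, e1, hm1]
      simp only [add_zero, zero_mul, zero_add]
      ring
    · rw [hS, hcost, h_eq_eta, e0, e1, hm1]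
      simp
  · have hm1 : m (1, 1) = 1 - m (0, 0) := by linarith
    refine hfin 0 (fun y => ?_) ?_
    · have : y + 1 + 1 = y := by rw [add_assoc, bit_one_add_one, add_zero]
      simp only [margY, sum_bit, e0, e1, hm1, this]
      simp only [add_zero, zero_mul, zero_add]
      ring
    · rw [hS, hcost, h_eq_eta, e0, e1, hm1]
      simp [add_comm]
  · linarith

/-! ### Convex hulls of compact sets -/

/-- By Carathéodory's theorem the hull is a continuous image of a simplex times finitely many copies
of s. -/
lemma isCompact_convexHull_of_isCompact {E : Type*} [NormedAddCommGroup E] [NormedSpace ℝ E]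
    [FiniteDimensional ℝ E] {s : Set E} (hs : IsCompact s) : IsCompact (convexHull ℝ s) := by
  rcases s.eq_empty_or_nonempty with rfl | ⟨a₀, ha₀⟩
  · simp
  set d := Module.finrank ℝ E + 1
  have himage : convexHull ℝ s = (fun q : (Fin d → ℝ) × (Fin d → E) => ∑ i, q.1 i • q.2 i) ''
      (stdSimplex ℝ (Fin d) ×ˢ Set.univ.pi fun _ => s) := by
    ext x
    constructor
    · intro hx
      obtain ⟨ι, _, z, w, hz, hind, hw, hw1, rfl⟩ := eq_pos_convex_span_of_mem_convexHull hx
      have hcard : Fintype.card ι ≤ Fintype.card (Fin d) := by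
        rw [Fintype.card_fin]
        exact hind.card_le_finrank_succ.trans (Nat.succ_le_succ (Submodule.finrank_le _))
      obtain ⟨e⟩ := Function.Embedding.nonempty_of_card_le hcard
      have hout : ∀ j ∉ Set.range e, Function.extend e w 0 j = 0 := fun j hj =>
        Function.extend_apply' _ _ _ fun ⟨i, hi⟩ => hj ⟨i, hi⟩
      -- Unused slots get weight 0 and the base point a₀.
      refine ⟨(Function.extend e w 0, Function.extend e z fun _ => a₀), ⟨⟨fun j => ?_, ?_⟩, ?_⟩, ?_⟩
      · by_cases hj : j ∈ Set.range e
        · obtain ⟨i, rfl⟩ := hj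
          simp only [e.injective.extend_apply]
          exact (hw i).le
        · exact (hout j hj).ge
      · rw [← hw1]
        exact (Fintype.sum_of_injective e e.injective _ _ hout fun i =>
          (e.injective.extend_apply _ _ _).symm).symm
      · intro j _
        by_cases hj : j ∈ Set.range e
        · obtain ⟨i, rfl⟩ := hj
          simp only [e.injective.extend_apply]
          exact hz ⟨i, rfl⟩
        · simp only
          rw [Function.extend_apply' _ _ _ fun ⟨i, hi⟩ => hj ⟨i, hi⟩]
          exact ha₀
      · refine (Fintype.sum_of_injective e e.injective _ _ (fun j hj => ?_) fun i => ?_).symm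
        · simp only [hout j hj, zero_smul]
        · simp only [e.injective.extend_apply]
    · rintro ⟨q, ⟨hq1, hq2⟩, rfl⟩
      exact (convex_convexHull ℝ s).sum_mem (fun i _ => hq1.1 i) hq1.2
        fun i _ => subset_convexHull ℝ s (hq2 i (Set.mem_univ i))
  rw [himage]
  refine ((isCompact_stdSimplex ℝ _).prod (isCompact_univ_pi fun _ => hs)).image ?_
  fun_prop

/-! ### The region of entropy gaps and costs -/

/-- The pairs of entropy gap and expected cost of all joint laws of state and input. -/
def gapRegion (p : ℝ) : Set (ℝ × ℝ) :=
  (fun m => (entGap p m, inputCost m)) '' stdSimplex ℝ (ZMod 2 × ZMod 2)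

lemma isCompact_gapRegion (p : ℝ) : IsCompact (gapRegion p) := by
  refine (isCompact_stdSimplex ℝ _).image ?_
  have := continuous_eta
  unfold entGap inputCost margS margY
  fun_prop

/-- The law under which state and input vanish. -/
lemma zeroLaw_mem :
    (Pi.single (0, 0) 1 : ZMod 2 × ZMod 2 → ℝ) ∈ stdSimplex ℝ (ZMod 2 × ZMod 2) :=
  single_mem_stdSimplex ℝ (0, 0)

lemma inputCost_single : inputCost (Pi.single (0, 0) 1 : ZMod 2 × ZMod 2 → ℝ) = 0 := by
  simp [inputCost]

lemma exists_smul_gapRegion (p : ℝ) {m : ZMod 2 × ZMod 2 → ℝ} (hm : ∀ e, 0 ≤ m e) :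
    ∃ a ∈ gapRegion p, (entGap p m, inputCost m) = (∑ e, m e) • a := by
  rcases (Finset.sum_nonneg fun e _ => hm e : 0 ≤ ∑ e, m e).eq_or_lt with h0 | hpos
  · have hm0 : m = (0 : ℝ) • m := by
      funext e
      have := (Finset.sum_eq_zero_iff_of_nonneg fun e _ => hm e).1 h0.symm e (mem_univ e)
      simp [this]
    refine ⟨_, ⟨_, zeroLaw_mem, rfl⟩, ?_⟩
    rw [← h0, hm0, entGap_smul, inputCost_smul]
    simp
  · refine ⟨_, ⟨(∑ e, m e)⁻¹ • m, ⟨fun e => ?_, ?_⟩, rfl⟩, ?_⟩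
    · exact mul_nonneg (inv_nonneg.2 hpos.le) (hm e)
    · simp only [Pi.smul_apply, smul_eq_mul, ← Finset.mul_sum]
      exact inv_mul_cancel₀ hpos.ne'
    · simp only [entGap_smul, inputCost_smul, Prod.smul_mk, smul_eq_mul]
      rw [mul_inv_cancel_left₀ hpos.ne', mul_inv_cancel_left₀ hpos.ne']

/-- Normalising each law turns the sum into a convex combination with the masses as weights. It
serves for the values of U and for the hybrid conditioning. -/
lemma sum_mem_convexHull_gapRegion (p : ℝ) {ι : Type*} [Fintype ι]
    (m : ι → ZMod 2 × ZMod 2 → ℝ) (hm : ∀ i e, 0 ≤ m i e) (hm1 : ∑ i, ∑ e, m i e = 1) :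
    (∑ i, entGap p (m i), ∑ i, inputCost (m i)) ∈ convexHull ℝ (gapRegion p) := by
  choose a ha hsm using fun i => exists_smul_gapRegion p (hm i)
  have : (∑ i, entGap p (m i), ∑ i, inputCost (m i)) = ∑ i, (∑ e, m i e) • a i := by
    rw [← Finset.sum_congr rfl fun i _ => hsm i]
    exact Prod.ext (by simp [Prod.fst_sum]) (by simp [Prod.snd_sum])
  rw [this]
  exact (convex_convexHull ℝ _).sum_mem (fun i _ => Finset.sum_nonneg fun e _ => hm i e) hm1
    fun i _ => subset_convexHull ℝ _ (ha i)

lemma exists_max_gap (p : ℝ) {q1 : ℝ} (hq1 : 0 ≤ q1) :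
    ∃ x ∈ convexHull ℝ (gapRegion p), x.2 ≤ q1 ∧
      ∀ y ∈ convexHull ℝ (gapRegion p), y.2 ≤ q1 → y.1 ≤ x.1 := by
  have hcomp : IsCompact (convexHull ℝ (gapRegion p) ∩ {x | x.2 ≤ q1}) :=
    (isCompact_convexHull_of_isCompact (isCompact_gapRegion p)).inter_right
      (isClosed_le continuous_snd continuous_const)
  obtain ⟨x, hx, hmax⟩ := hcomp.exists_isMaxOn
    ⟨_, subset_convexHull ℝ _ ⟨_, zeroLaw_mem, rfl⟩, by
      change inputCost _ ≤ q1
      rwa [inputCost_single]⟩ continuous_fst.continuousOn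
  exact ⟨x, hx.1, hx.2, fun y hy hy2 => hmax ⟨hy, hy2⟩⟩

/-- The slope is the derivative at q₁; it is nonnegative because `gain p` does not decrease up to
1/2. -/
lemma exists_tangent {p q1 : ℝ} (hp0 : 0 < p) (hp1 : p < 1) (hp : p ≠ 1 / 2) (hq0 : 0 < q1)
    (hq1 : q1 < 1 / 2) :
    ∃ l : ℝ, 0 ≤ l ∧ ∀ c ∈ Set.Icc (0 : ℝ) 1, c ≠ q1 → gain p c < gain p q1 + l * (c - q1) := by
  have hpI : p ∈ Set.Icc (0 : ℝ) 1 := ⟨hp0.le, hp1.le⟩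
  obtain ⟨hc0, hc1⟩ := conv_mem_Ioo hpI (q := q1) ⟨hq0, by linarith⟩
  have hdiff : DifferentiableAt ℝ (gain p) q1 := by
    have h1 : DifferentiableAt ℝ h (conv p q1) := by
      have : h = fun a => binEntropy a / log 2 := funext h_eq_binEntropy
      rw [this]
      exact (differentiableAt_binEntropy hc0.ne' hc1.ne).div_const _
    have h2 : DifferentiableAt ℝ (conv p) q1 := by unfold conv; fun_prop
    exact (h1.comp q1 h2).sub_const _
  have hconc := gain_strictConcaveOn hp0.le hp1.le hp
  have hqI : q1 ∈ Set.Icc (0 : ℝ) 1 := ⟨hq0.le, by linarith⟩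
  have htan : ∀ c ∈ Set.Icc (0 : ℝ) 1, c ≠ q1 →
      gain p c < gain p q1 + deriv (gain p) q1 * (c - q1) := by
    intro c hc hne
    rcases lt_or_gt_of_ne hne with hlt | hlt
    · have := hconc.lt_slope_of_hasDerivAt hc hqI hlt hdiff.hasDerivAt
      rw [slope_def_field, lt_div_iff₀ (by linarith)] at this
      linarith
    · have := hconc.slope_lt_of_hasDerivAt hqI hc hlt hdiff.hasDerivAt
      rw [slope_def_field, div_lt_iff₀ (by linarith)] at this
      linarith
  refine ⟨deriv (gain p) q1, ?_, htan⟩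
  have h1 := htan (1 / 2) ⟨by norm_num, by norm_num⟩ hq1.ne'
  have h2 := gain_mono hpI hq0.le hq1.le le_rfl
  have h3 : 0 < deriv (gain p) q1 * (1 / 2 - q1) := by linarith
  exact (pos_of_mul_pos_left h3 (by linarith)).le

/-- Every point of the region lies strictly below the tangent: by strict concavity if its cost
differs from q₁, by the strict part of `entGap_le` if not. An open half-plane is convex, so the hull
lies there too. -/
lemma gap_lt_gain {p q1 : ℝ} (hp0 : 0 < p) (hp1 : p < 1) (hp : p ≠ 1 / 2) (hq0 : 0 < q1)
    (hq1 : q1 < 1 / 2) {x : ℝ × ℝ} (hx : x ∈ convexHull ℝ (gapRegion p)) (hx2 : x.2 ≤ q1) :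
    x.1 < gain p q1 := by
  obtain ⟨l, hl, htan⟩ := exists_tangent hp0 hp1 hp hq0 hq1
  have hsub : gapRegion p ⊆ {x : ℝ × ℝ | x.1 - l * x.2 < gain p q1 - l * q1} := by
    rintro _ ⟨m, hm, rfl⟩
    obtain ⟨h1, h2⟩ := entGap_le hp0 hp1 hp hm
    simp only [Set.mem_ofPred_eq]
    by_cases hc : inputCost m = q1
    · have := h2 (by linarith) (by linarith)
      rw [hc] at this ⊢
      linarith
    · linarith [htan _ (inputCost_mem hm) hc]
  have hconv : Convex ℝ {x : ℝ × ℝ | x.1 - l * x.2 < gain p q1 - l * q1} :=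
    convex_halfSpace_lt (f := fun x : ℝ × ℝ => x.1 - l * x.2)
      ⟨fun x y => by simp only [Prod.fst_add, Prod.snd_add]; ring,
        fun c x => by simp only [Prod.smul_fst, Prod.smul_snd, smul_eq_mul]; ring⟩ _
  have h3 := convexHull_min hsub hconv hx
  simp only [Set.mem_ofPred_eq] at h3
  nlinarith

/-! ### The Gelfand-Pinsker rates -/

/-- The unnormalised law of state and input for a given value of the auxiliary variable. -/
def condLaw {k : ℕ} (K : ZMod 2 → Fin k → ZMod 2 → ℝ) (u : Fin k) : ZMod 2 × ZMod 2 → ℝ :=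
  fun e => 1 / 2 * K e.1 u e.2

lemma gpJoint_eq (p : ℝ) {k : ℕ} (K : ZMod 2 → Fin k → ZMod 2 → ℝ) (s : ZMod 2) (u : Fin k)
    (x y : ZMod 2) : gpJoint p K s u x y = condLaw K u (s, x) * bern p (y + x + s) := by
  rw [gpJoint, bern_half, binaryY1_eq, condLaw]

lemma sum_gpJoint (p : ℝ) {k : ℕ} (K : ZMod 2 → Fin k → ZMod 2 → ℝ) (s : ZMod 2) (u : Fin k)
    (x : ZMod 2) : ∑ y, gpJoint p K s u x y = condLaw K u (s, x) := by
  simp_rw [gpJoint_eq, add_assoc]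
  rw [← Finset.mul_sum, sum_bern_add, mul_one]

lemma gpCost_eq (p : ℝ) {k : ℕ} (K : ZMod 2 → Fin k → ZMod 2 → ℝ) :
    gpCost p K = ∑ u, inputCost (condLaw K u) := by
  simp only [gpCost, ← Finset.sum_mul, sum_gpJoint, inputCost]
  rw [Finset.sum_comm]
  refine Finset.sum_congr rfl fun u _ => Finset.sum_congr rfl fun s _ => ?_
  rw [sum_bit, bit_val_zero, bit_val_one, mul_zero, zero_add, mul_one]

lemma eta_half : eta (1 / 2) = 1 / 2 := by
  rw [eta_eq, one_div, logb_inv, logb_self_eq_one one_lt_two]; norm_num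

/-- The entropy of U cancels between the two informations, and the 1 is the entropy of the uniform
state. -/
lemma gpRate_eq {p : ℝ} (hp : p ∈ Set.Icc (0 : ℝ) 1) {k : ℕ}
    {K : ZMod 2 → Fin k → ZMod 2 → ℝ} (hK : IsCondPMF K) :
    gpRate p K = ∑ y, eta (∑ u, margY p (condLaw K u) y) - 1 + ∑ u, entGap p (condLaw K u) := by
  have hm : ∀ u e, 0 ≤ condLaw K u e := fun u e => mul_nonneg (by norm_num) (hK.1 _ _ _)
  have h1 : (fun (u : Fin k) y => ∑ s, ∑ x, gpJoint p K s u x y) =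
      fun u y => margY p (condLaw K u) y := by
    simp only [gpJoint_eq]; rfl
  have h2 : (fun (u : Fin k) s => ∑ x, ∑ y, gpJoint p K s u x y) =
      fun u s => margS (condLaw K u) s := by
    simp only [sum_gpJoint]; rfl
  rw [gpRate, h1, h2, mutualInfo_eq (P := fun u y => margY p (condLaw K u) y)
    (fun u y => Finset.sum_nonneg fun s _ => Finset.sum_nonneg
    fun x _ => mul_nonneg (hm _ _) (bern_nonneg hp _)),
    mutualInfo_eq (P := fun u s => margS (condLaw K u) s)
    (fun u s => Finset.sum_nonneg fun x _ => hm _ _)]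
  have h3 : ∀ s, ∑ u, margS (condLaw K u) s = 1 / 2 := by
    intro s
    simp only [margS, condLaw, ← Finset.mul_sum, hK.2 s, mul_one]
  simp only [sum_margY, sum_margS, h3, entGap, Finset.sum_sub_distrib]
  rw [sum_bit (fun _ => eta (1 / 2)), eta_half]
  ring

lemma sum_eta_le_one (P : ZMod 2 → ℝ) (hP : ∑ y, P y = 1) : ∑ y, eta (P y) ≤ 1 := by
  rw [sum_bit] at hP ⊢
  have : P 1 = 1 - P 0 := by linarith
  rw [this, ← h_eq_eta]
  exact h_le_one _

lemma sum_condLaw {k : ℕ} {K : ZMod 2 → Fin k → ZMod 2 → ℝ} (hK : IsCondPMF K) :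
    ∑ u, ∑ e, condLaw K u e = 1 := by
  simp only [Fintype.sum_prod_type, condLaw]
  rw [Finset.sum_comm]
  simp only [← Finset.mul_sum, hK.2]
  simp

lemma gpRate_le {p : ℝ} (hp : p ∈ Set.Icc (0 : ℝ) 1) {k : ℕ}
    {K : ZMod 2 → Fin k → ZMod 2 → ℝ} (hK : IsCondPMF K) :
    gpRate p K ≤ ∑ u, entGap p (condLaw K u) := by
  rw [gpRate_eq hp hK]
  have := sum_eta_le_one (fun y => ∑ u, margY p (condLaw K u) y) (by
    rw [Finset.sum_comm]
    simp only [sum_margY]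
    exact sum_condLaw hK)
  linarith

/-- The law of state and input after adding `b` to the state. -/
def shiftLaw (b : ZMod 2) (m : ZMod 2 × ZMod 2 → ℝ) : ZMod 2 × ZMod 2 → ℝ :=
  fun e => m (e.1 + b, e.2)

lemma margY_shiftLaw (p : ℝ) (b : ZMod 2) (m : ZMod 2 × ZMod 2 → ℝ) (y : ZMod 2) :
    margY p (shiftLaw b m) y = margY p m (y + b) := by
  refine Fintype.sum_equiv (Equiv.addRight b) _ _ fun s => ?_
  refine Finset.sum_congr rfl fun x _ => ?_
  simp only [shiftLaw, Equiv.coe_addRight]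
  congr 2
  linear_combination -bit_add_self b

lemma entGap_shiftLaw (p : ℝ) (b : ZMod 2) (m : ZMod 2 × ZMod 2 → ℝ) :
    entGap p (shiftLaw b m) = entGap p m := by
  unfold entGap
  congr 1
  · exact Fintype.sum_equiv (Equiv.addRight b) _ _ fun s => rfl
  · exact Fintype.sum_equiv (Equiv.addRight b) _ _ fun y => by rw [margY_shiftLaw]; rfl

lemma inputCost_shiftLaw (b : ZMod 2) (m : ZMod 2 × ZMod 2 → ℝ) :
    inputCost (shiftLaw b m) = inputCost m :=
  Fintype.sum_equiv (Equiv.addRight b) _ _ fun _ => rfl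

/-- Every point of the convex hull of the region is the rate and cost of a symmetrized law. -/
lemma mem_gpRates_of_mem_convexHull {p q1 : ℝ} (hp : p ∈ Set.Icc (0 : ℝ) 1) {x : ℝ × ℝ}
    (hx : x ∈ convexHull ℝ (gapRegion p)) (hx2 : x.2 ≤ q1) : x.1 ∈ gpRates p q1 := by
  obtain ⟨ι, _, z, w, hz, -, hw, hw1, rfl⟩ := eq_pos_convex_span_of_mem_convexHull hx
  choose m hm hmz using fun i => hz ⟨i, rfl⟩
  set e := Fintype.equivFin (ι × ZMod 2)
  -- The auxiliary variable is a pair (i, b): a point of the mixture and a uniform shift of the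
  -- state. Shifting keeps gap and cost and makes both S and Y₁ uniform, so no rate is lost.
  set K : ZMod 2 → Fin (Fintype.card (ι × ZMod 2)) → ZMod 2 → ℝ := fun s u x =>
    w (e.symm u).1 * m (e.symm u).1 (s + (e.symm u).2, x) with hKdef
  have hsum : ∀ f : ι × ZMod 2 → ℝ, ∑ u, f (e.symm u) = ∑ i, ∑ b, f (i, b) := fun f => by
    rw [e.symm.sum_comp, Fintype.sum_prod_type]
  have hm1 : ∀ i, ∑ s, ∑ x, m i (s, x) = 1 := fun i => by
    rw [← Fintype.sum_prod_type]; exact (hm i).2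
  have hK : IsCondPMF K := by
    refine ⟨fun s u x => mul_nonneg (hw _).le ((hm _).1 _), fun s => ?_⟩
    simp only [hKdef]
    rw [hsum fun q => ∑ x, w q.1 * m q.1 (s + q.2, x)]
    simp only [← Finset.mul_sum]
    rw [← hw1]
    refine Finset.sum_congr rfl fun i _ => ?_
    have : ∑ b, ∑ x, m i (s + b, x) = 1 := by
      rw [← hm1 i]
      exact Fintype.sum_equiv (Equiv.addLeft s) _ _ fun _ => rfl
    rw [this, mul_one]
  have hlaw : ∀ u, condLaw K u =
      (1 / 2 * w (e.symm u).1) • shiftLaw (e.symm u).2 (m (e.symm u).1) := by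
    intro u
    funext q
    simp only [condLaw, hKdef, shiftLaw, Pi.smul_apply, smul_eq_mul]
    ring
  have hcost : gpCost p K = ∑ i, w i * (z i).2 := by
    rw [gpCost_eq]
    simp only [hlaw, inputCost_smul, inputCost_shiftLaw]
    rw [hsum fun q => 1 / 2 * w q.1 * inputCost (m q.1)]
    refine Finset.sum_congr rfl fun i _ => ?_
    rw [← hmz i, sum_bit]
    ring
  have hgap : ∑ u, entGap p (condLaw K u) = ∑ i, w i * (z i).1 := by
    simp only [hlaw, entGap_smul, entGap_shiftLaw]
    rw [hsum fun q => 1 / 2 * w q.1 * entGap p (m q.1)]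
    refine Finset.sum_congr rfl fun i _ => ?_
    rw [← hmz i, sum_bit]
    ring
  have hY : ∀ y, ∑ u, margY p (condLaw K u) y = 1 / 2 := by
    intro y
    simp only [hlaw, margY_smul, margY_shiftLaw]
    rw [hsum fun q => 1 / 2 * w q.1 * margY p (m q.1) (y + q.2)]
    simp only [← Finset.mul_sum]
    have : ∀ i, ∑ b, margY p (m i) (y + b) = 1 := by
      intro i
      have h1 : ∑ b, margY p (m i) (y + b) = ∑ b, margY p (m i) b :=
        Fintype.sum_equiv (Equiv.addLeft y) _ _ fun _ => rfl
      rw [h1, sum_margY]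
      exact (hm i).2
    simp only [this, mul_one, ← Finset.mul_sum, hw1]
  refine ⟨_, K, hK, ?_, ?_⟩
  · rw [hcost]
    simpa [Prod.snd_sum] using hx2
  · rw [gpRate_eq hp hK, hgap]
    simp only [hY]
    rw [sum_bit (fun _ => eta (1 / 2)), eta_half]
    simp [Prod.fst_sum]
    norm_num

/-- The maximal Gelfand-Pinsker rate is attained, bounds the entropy gaps of all admissible
mixtures, and lies strictly below the gain. -/
theorem exists_isGreatest_gpRates {p q1 : ℝ} (hp0 : 0 < p) (hp1 : p < 1) (hp : p ≠ 1 / 2)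
    (hq0 : 0 < q1) (hq1 : q1 < 1 / 2) :
    ∃ G, IsGreatest (gpRates p q1) G ∧ G < gain p q1 ∧
      ∀ y ∈ convexHull ℝ (gapRegion p), y.2 ≤ q1 → y.1 ≤ G := by
  have hpI : p ∈ Set.Icc (0 : ℝ) 1 := ⟨hp0.le, hp1.le⟩
  obtain ⟨x, hx, hx2, hmax⟩ := exists_max_gap p hq0.le
  refine ⟨x.1, ⟨mem_gpRates_of_mem_convexHull hpI hx hx2, ?_⟩,
    gap_lt_gain hp0 hp1 hp hq0 hq1 hx hx2, hmax⟩
  rintro r ⟨k, K, hK, hcost, rfl⟩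
  refine (gpRate_le hpI hK).trans ?_
  rw [gpCost_eq] at hcost
  exact hmax _ (sum_mem_convexHull_gapRegion p (condLaw K)
    (fun u e => mul_nonneg (by norm_num) (hK.1 _ _ _)) (sum_condLaw hK)) hcost

/-! ### Replacing the states by the outputs one coordinate at a time -/

section Hybrid
variable {n : ℕ} (p : ℝ) (x : (Fin n → ZMod 2) → Fin n → ZMod 2)

/-- The conditional law of the `j`-th coordinate of the `i`-th hybrid given the states: an output
for `j < i` and a state otherwise. -/
def hybridKernel (i : ℕ) (s : Fin n → ZMod 2) (j : Fin n) (t : ZMod 2) : ℝ :=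
  if (j : ℕ) < i then bern p (t + x s j + s j) else if t = s j then 1 else 0

/-- The law of the `i`-th hybrid of the state and the output sequence. -/
def hybridLaw (i : ℕ) (t : Fin n → ZMod 2) : ℝ :=
  ∑ s, (∏ j, bern (1 / 2) (s j)) * ∏ j, hybridKernel p x i s j (t j)

variable {p x}

lemma hybridKernel_nonneg (hp : p ∈ Set.Icc (0 : ℝ) 1) (i : ℕ) (s : Fin n → ZMod 2) (j : Fin n)
    (t : ZMod 2) : 0 ≤ hybridKernel p x i s j t := by
  unfold hybridKernel
  split_ifs
  · exact bern_nonneg hp _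
  · exact zero_le_one
  · exact le_rfl

lemma sum_hybridKernel (i : ℕ) (s : Fin n → ZMod 2) (j : Fin n) :
    ∑ t, hybridKernel p x i s j t = 1 := by
  unfold hybridKernel
  split_ifs
  · simp_rw [add_assoc]; exact sum_bern_add _ _
  · simp

lemma hybridLaw_zero (t : Fin n → ZMod 2) : hybridLaw p x 0 t = ∏ j, bern (1 / 2) (t j) := by
  simp only [hybridLaw, hybridKernel, Nat.not_lt_zero, if_false]
  rw [Finset.sum_eq_single t]
  · simp
  · intro s _ hs
    obtain ⟨j, hj⟩ := Function.ne_iff.1 hs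
    exact mul_eq_zero_of_right _ (Finset.prod_eq_zero (mem_univ j) (if_neg (Ne.symm hj)))
  · simp

lemma hybridLaw_last (t : Fin n → ZMod 2) : hybridLaw p x n t =
    ∑ s, (∏ j, bern (1 / 2) (s j)) * ∏ j, bern p (t j + x s j + s j) := by
  simp only [hybridLaw, hybridKernel, Fin.is_lt, if_true]

end Hybrid

lemma sum_bit_indicator (a b : ZMod 2) (f : ZMod 2 → ZMod 2 → ℝ) :
    ∑ s, ∑ y, (if a = s ∧ b = y then (1 : ℝ) else 0) * f s y = f a b := by
  rw [Finset.sum_eq_single a, Finset.sum_eq_single b]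
  · simp
  · intro y _ hy; simp [hy.symm]
  · simp
  · intro s _ hs; simp [hs.symm]
  · simp

/-- One hybrid step is a sum of entropy gaps. -/
lemma hybrid_step {m : ℕ} {p : ℝ} (hp : p ∈ Set.Icc (0 : ℝ) 1)
    (x : (Fin (m + 1) → ZMod 2) → Fin (m + 1) → ZMod 2) (i : Fin (m + 1)) :
    (∑ t, eta (hybridLaw p x i t) - ∑ t, eta (hybridLaw p x (i + 1) t),
      ∑ s, (∏ j, bern (1 / 2) (s j)) * ((x s i).val : ℝ)) ∈ convexHull ℝ (gapRegion p) := by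
  -- Joint weight of the states s and the value r of the hybrid off coordinate i, where hybrids i
  -- and i + 1 agree.
  set g : (Fin m → ZMod 2) → (Fin (m + 1) → ZMod 2) → ℝ := fun r s =>
    (∏ j, bern (1 / 2) (s j)) * ∏ j : Fin m, hybridKernel p x i s (i.succAbove j) (r j) with hg
  have hg0 : ∀ r s, 0 ≤ g r s := fun r s => mul_nonneg (prod_bern_half_pos s).le
    (Finset.prod_nonneg fun j _ => hybridKernel_nonneg hp _ _ _ _)
  have hgsum : ∀ s, ∑ r, g r s = ∏ j, bern (1 / 2) (s j) := by
    intro s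
    simp only [hg, ← Finset.mul_sum]
    rw [sum_prod_one (f := fun j => hybridKernel p x i s (i.succAbove j))
      (fun j => sum_hybridKernel _ _ _), mul_one]
  -- Unnormalised law of (S_i, X_i) jointly with r. The noise at i enters no other coordinate, so
  -- its two marginals are the i-th coordinates of the two hybrids.
  set M : (Fin m → ZMod 2) → ZMod 2 × ZMod 2 → ℝ := fun r e =>
    ∑ s, g r s * (if s i = e.1 ∧ x s i = e.2 then 1 else 0) with hM
  have hM0 : ∀ r e, 0 ≤ M r e := fun r e => Finset.sum_nonneg fun s _ =>
    mul_nonneg (hg0 r s) (by split_ifs <;> norm_num)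
  have hMf : ∀ r (f : ZMod 2 → ZMod 2 → ℝ),
      ∑ a, ∑ b, M r (a, b) * f a b = ∑ s, g r s * f (s i) (x s i) := by
    intro r f
    simp only [hM, Finset.sum_mul]
    calc _ = ∑ a, ∑ s, ∑ b, g r s * (if s i = a ∧ x s i = b then 1 else 0) * f a b :=
          Finset.sum_congr rfl fun a _ => Finset.sum_comm
      _ = ∑ s, ∑ a, ∑ b, g r s * (if s i = a ∧ x s i = b then 1 else 0) * f a b :=
          Finset.sum_comm
      _ = _ := by
          refine Finset.sum_congr rfl fun s _ => ?_
          simp only [mul_assoc, ← Finset.mul_sum]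
          rw [sum_bit_indicator]
  have hS : ∀ r a, margS (M r) a = hybridLaw p x i (i.insertNth a r) := by
    intro r a
    have h1 := hMf r fun a' _ => if a = a' then 1 else 0
    have h2 : ∑ a', ∑ b, M r (a', b) * (if a = a' then (1 : ℝ) else 0) = margS (M r) a := by
      rw [Finset.sum_eq_single a]
      · simp [margS]
      · intro a' _ ha'; simp [ha'.symm]
      · simp
    rw [← h2, h1, hybridLaw]
    refine Finset.sum_congr rfl fun s _ => ?_
    rw [Fin.prod_univ_succAbove (fun j => hybridKernel p x i s j
      ((i.insertNth a r : Fin (m + 1) → ZMod 2) j)) i]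
    simp only [Fin.insertNth_apply_same, Fin.insertNth_apply_succAbove, hg]
    have : hybridKernel p x i s i a = if a = s i then 1 else 0 := by
      simp [hybridKernel]
    rw [this]
    ring
  have hY : ∀ r y, margY p (M r) y = hybridLaw p x (i + 1) (i.insertNth y r) := by
    intro r y
    rw [margY, hMf r fun a b => bern p (y + b + a), hybridLaw]
    refine Finset.sum_congr rfl fun s _ => ?_
    rw [Fin.prod_univ_succAbove (fun j => hybridKernel p x (i + 1) s j
      ((i.insertNth y r : Fin (m + 1) → ZMod 2) j)) i]
    simp only [Fin.insertNth_apply_same, Fin.insertNth_apply_succAbove, hg]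
    have h1 : hybridKernel p x (i + 1) s i y = bern p (y + x s i + s i) := by
      simp [hybridKernel]
    have h2 : ∀ j : Fin m, hybridKernel p x (i + 1) s (i.succAbove j) (r j) =
        hybridKernel p x i s (i.succAbove j) (r j) := by
      intro j
      have hne : ((i.succAbove j : Fin (m + 1)) : ℕ) ≠ i := fun h =>
        Fin.succAbove_ne i j (Fin.ext h)
      have hiff : ((i.succAbove j : Fin (m + 1)) : ℕ) < (i : ℕ) + 1 ↔
          ((i.succAbove j : Fin (m + 1)) : ℕ) < i := by omega
      simp only [hybridKernel, hiff]
    simp only [h1, h2]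
    ring
  have hsplit : ∀ f : (Fin (m + 1) → ZMod 2) → ℝ,
      ∑ t, f t = ∑ r : Fin m → ZMod 2, ∑ a, f (i.insertNth a r) := by
    intro f
    rw [← (Fin.insertNthEquiv (fun _ => ZMod 2) i).sum_comp, Fintype.sum_prod_type,
      Finset.sum_comm]
    rfl
  have hgap : ∑ t, eta (hybridLaw p x i t) - ∑ t, eta (hybridLaw p x (i + 1) t) =
      ∑ r, entGap p (M r) := by
    rw [hsplit, hsplit, ← Finset.sum_sub_distrib]
    simp only [entGap, hS, hY]
  have hcost : ∑ s, (∏ j, bern (1 / 2) (s j)) * ((x s i).val : ℝ) = ∑ r, inputCost (M r) := by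
    have : ∀ r, inputCost (M r) = ∑ s, g r s * ((x s i).val : ℝ) := by
      intro r
      rw [← hMf r fun _ b => (b.val : ℝ), inputCost]
      refine Finset.sum_congr rfl fun a _ => ?_
      rw [sum_bit, bit_val_zero, bit_val_one, mul_zero, zero_add, mul_one]
    simp only [this]
    rw [Finset.sum_comm]
    simp only [← Finset.sum_mul, hgsum]
  rw [hgap, hcost]
  refine sum_mem_convexHull_gapRegion p M hM0 ?_
  have hone : ∀ r, ∑ e, M r e = ∑ s, g r s := by
    intro r
    have := hMf r fun _ _ => 1
    simp only [mul_one] at this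
    rw [← this, Fintype.sum_prod_type]
  simp only [hone]
  rw [Finset.sum_comm]
  simp only [hgsum]
  exact sum_prod_one (f := fun _ => bern (1 / 2)) fun _ => sum_bern _

lemma sum_eta_uniform (n : ℕ) :
    ∑ t : Fin n → ZMod 2, eta (∏ j, bern (1 / 2) (t j)) = n := by
  simp only [bern_half, Finset.prod_const, Finset.card_univ, Fintype.card_fin]
  rw [Finset.sum_const, Finset.card_univ, Fintype.card_fun, ZMod.card, Fintype.card_fin, eta_eq,
    logb_pow, one_div, logb_inv, logb_self_eq_one one_lt_two, nsmul_eq_mul]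
  push_cast
  rw [inv_pow]
  field_simp

/-- The law of the output `X + S + Z` when the input is a function of the states. -/
def outputLaw (p : ℝ) {n : ℕ} (x : (Fin n → ZMod 2) → Fin n → ZMod 2) (v : Fin n → ZMod 2) : ℝ :=
  ∑ s, (∏ j, bern (1 / 2) (s j)) * ∏ j, bern p (v j + x s j + s j)

/-- The entropy deficit of the output sequence is bounded by the single-letter optimum. -/
lemma output_deficit_le {n : ℕ} (hn : 0 < n) {p q1 G : ℝ} (hp : p ∈ Set.Icc (0 : ℝ) 1)
    (hG : ∀ y ∈ convexHull ℝ (gapRegion p), y.2 ≤ q1 → y.1 ≤ G)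
    (x : (Fin n → ZMod 2) → Fin n → ZMod 2) (hx : ∀ s, ∑ i, ((x s i).val : ℝ) ≤ n * q1) :
    n - ∑ v, eta (outputLaw p x v) ≤ n * G := by
  obtain ⟨m, rfl⟩ : ∃ m, n = m + 1 := ⟨n - 1, by omega⟩
  have hn' : (0 : ℝ) < (m + 1 : ℕ) := by exact_mod_cast hn
  -- Averaging the n steps stays in the hull: the gaps telescope from uniform states to outputs, and
  -- the costs average to at most q₁.
  have hmem := (convex_convexHull ℝ (gapRegion p)).sum_mem (t := (univ : Finset (Fin (m + 1))))
    (w := fun _ => ((m + 1 : ℕ) : ℝ)⁻¹) (fun _ _ => (inv_pos.2 hn').le)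
    (by rw [Finset.sum_const, Finset.card_univ, Fintype.card_fin, nsmul_eq_mul,
          mul_inv_cancel₀ hn'.ne'])
    (fun i _ => hybrid_step hp x i)
  have htel : ∑ i : Fin (m + 1), (∑ t, eta (hybridLaw p x i t) -
      ∑ t, eta (hybridLaw p x (i + 1) t)) = (m + 1 : ℕ) - ∑ v, eta (outputLaw p x v) := by
    rw [Fin.sum_univ_eq_sum_range (fun i => ∑ t, eta (hybridLaw p x i t) -
      ∑ t, eta (hybridLaw p x (i + 1) t)), Finset.sum_range_sub']
    simp only [hybridLaw_zero, sum_eta_uniform, hybridLaw_last]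
    rfl
  have hbound := hG _ hmem (by
    simp only [Prod.snd_sum, Prod.smul_snd, smul_eq_mul]
    rw [← Finset.mul_sum, inv_mul_le_iff₀ hn', Finset.sum_comm]
    simp only [← Finset.mul_sum]
    calc _ ≤ ∑ s : Fin (m + 1) → ZMod 2, (∏ j, bern (1 / 2) (s j)) * (((m + 1 : ℕ) : ℝ) * q1) :=
          Finset.sum_le_sum fun s _ => mul_le_mul_of_nonneg_left (hx s) (prod_bern_half_pos s).le
      _ = _ := by
          rw [← Finset.sum_mul, sum_prod_one (f := fun _ => bern (1 / 2)) fun _ => sum_bern _,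
            one_mul])
  simp only [Prod.fst_sum, Prod.smul_fst, smul_eq_mul] at hbound
  rw [← Finset.mul_sum, htel, inv_mul_le_iff₀ hn'] at hbound
  exact hbound

/-- The converse when Encoder 2 does not know the states. -/
theorem le_of_achievableNoState {p q1 q2 R G : ℝ} (hp : p ∈ Set.Icc (0 : ℝ) 1)
    (hG : ∀ y ∈ convexHull ℝ (gapRegion p), y.2 ≤ q1 → y.1 ≤ G)
    (hR : AchievableNoState p q1 q2 R) : R ≤ G := by
  refine rate_le_of_fano fun ε₀ hε₀ => ?_
  obtain ⟨n, M, c, hn, hM, ⟨hc, -⟩, hign, herr⟩ := hR ε₀ hε₀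
  have hMpos : 0 < M := by
    have : (0 : ℝ) < M := lt_of_lt_of_le (by positivity) hM
    exact_mod_cast this
  have hhalf : ∑ s : Fin n → ZMod 2, ∏ i, bern (1 / 2) (s i) = 1 :=
    sum_prod_one (f := fun _ => bern (1 / 2)) fun _ => sum_bern _
  have hout0 : ∀ w v, 0 ≤ outputLaw p (c.enc1 0 w) v := fun w v => Finset.sum_nonneg fun s _ =>
    mul_nonneg (prod_bern_half_pos s).le (Finset.prod_nonneg fun i _ => bern_nonneg hp _)
  have hout1 : ∀ w, ∑ v, outputLaw p (c.enc1 0 w) v = 1 := by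
    intro w
    simp only [outputLaw]
    rw [Finset.sum_comm]
    refine (Finset.sum_congr rfl fun s _ => ?_).trans hhalf
    rw [← Finset.mul_sum, sum_prod_one (f := fun j a => bern p (a + c.enc1 0 w s j + s j))
      (fun j => by simp_rw [add_assoc]; exact sum_bern_add _ _), mul_one]
  -- Relative to the uniform law, the divergence of the output is exactly its entropy deficit.
  obtain ⟨hε0, hF⟩ := fano hMpos (fun w v => outputLaw p (c.enc1 0 w) v)
    (fun v : Fin n → ZMod 2 => ∏ j, bern (1 / 2) (v j)) hout0 hout1
    (fun v => (prod_bern_half_pos v).le) hhalf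
    (fun w v hv => absurd hv (prod_bern_half_pos v).ne') (D := n * G)
    (fun w => by
      refine le_trans (le_of_eq ?_) (output_deficit_le hn hp hG (c.enc1 0 w) (hc 0 w))
      have hu : ∀ v : Fin n → ZMod 2, logb 2 (∏ j, bern (1 / 2) (v j)) = -n := by
        intro v
        simp only [bern_half, Finset.prod_const, Finset.card_univ, Fintype.card_fin]
        rw [logb_pow, one_div, logb_inv, logb_self_eq_one one_lt_two]
        ring
      simp only [klBits, mul_logb_div _ (prod_bern_half_pos _).ne', hu, eta_eq]
      rw [Finset.sum_sub_distrib, Finset.sum_neg_distrib, ← Finset.sum_mul, hout1]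
      ring)
    (fun v => (c.dec fun i => (v i, c.word2 0 0 i)).2)
  -- The second output is a constant word, so decoding from `Y₁` alone loses nothing.
  have hword : ∀ s, c.word2 0 s = c.word2 0 0 := fun s => funext fun i => hign i 0 _ _
  have hεeq : 1 / (M : ℝ) * ∑ w, ∑ v, outputLaw p (c.enc1 0 w) v *
      (if (c.dec fun i => (v i, c.word2 0 0 i)).2 ≠ w then 1 else 0) =
      c.errorProb (bern (1 / 2)) (binaryMAC p) := by
    rw [errorProb_binary]
    congr 1
    refine Finset.sum_congr rfl fun w _ => ?_
    simp only [outputLaw, Finset.sum_mul]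
    rw [Finset.sum_comm]
    refine Finset.sum_congr rfl fun s _ => ?_
    refine Fintype.sum_equiv (Equiv.addRight (c.enc1 0 w s + s)) _ _ fun v => ?_
    simp only [Equiv.coe_addRight, Pi.add_apply, hword]
    have hx : ∀ i, c.enc1 0 w s i + s i + (v i + (c.enc1 0 w s i + s i)) = v i := fun i => by
      linear_combination bit_add_self (c.enc1 0 w s i + s i)
    simp only [hx, add_assoc]
  rw [hεeq] at hε0 hF
  exact ⟨_, n, M, hε0, herr, hn, hM, hF⟩

/-! ### The capacity and the strict gap -/

theorem isCapacity_gain {p q1 q2 : ℝ} (hp : p ∈ Set.Icc (0 : ℝ) 1) (hq0 : 0 ≤ q1)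
    (hq1 : q1 ≤ 1 / 2) (hq2 : 1 / 2 ≤ q2) : IsCapacity p q1 q2 (gain p q1) := by
  refine ⟨fun R hR => le_gain_of_achievable hp hq0 hq1 hR.2, fun b hb => ?_⟩
  -- Rate 0 is achievable, so a rate between b and the gain is automatically nonnegative.
  have hb0 : 0 ≤ b :=
    hb ⟨le_rfl, (achievableNoState_zero hq0 (by linarith)).achievable⟩
  by_contra hlt
  push Not at hlt
  obtain ⟨R, hbR, hRg⟩ := exists_between hlt
  have hR0 : 0 ≤ R := hb0.trans hbR.le
  exact absurd (hb ⟨hR0, achievable_of_lt_gain hp hq0 hq1 hq2 hR0 hRg⟩) (not_le.2 hbR)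

end StateMAC

end

theorem claim2 (p q1 q2 : ℝ) (hp0 : 0 ≤ p) (hp1 : p ≤ 1) (hq1 : 0 ≤ q1) (hq1' : q1 ≤ 1 / 2)
    (hq2 : 1 / 2 ≤ q2) :
    StateMAC.IsCapacity p q1 q2 (StateMAC.h (StateMAC.conv p q1) - StateMAC.h p) ∧
    (0 < p → p < 1 → p ≠ 1 / 2 → 0 < q1 → q1 < 1 / 2 →
      (∃ G : ℝ, IsGreatest (StateMAC.gpRates p q1) G ∧
        G < StateMAC.h (StateMAC.conv p q1) - StateMAC.h p) ∧
      (∃ C₀ : ℝ, StateMAC.IsCapacityNoState p q1 q2 C₀ ∧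
        C₀ < StateMAC.h (StateMAC.conv p q1) - StateMAC.h p)) := by
  refine ⟨StateMAC.isCapacity_gain ⟨hp0, hp1⟩ hq1 hq1' hq2, fun h0 h1 hp h2 h3 => ?_⟩
  obtain ⟨G, hG, hlt, hbound⟩ := StateMAC.exists_isGreatest_gpRates h0 h1 hp h2 h3
  refine ⟨⟨G, hG, hlt⟩, ?_⟩
  -- The bound by G shows that the supremum without states exists and lies strictly below the gain.
  have hub : ∀ R ∈ {R : ℝ | 0 ≤ R ∧ StateMAC.AchievableNoState p q1 q2 R}, R ≤ G :=
    fun R hR => StateMAC.le_of_achievableNoState ⟨hp0, hp1⟩ hbound hR.2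
  have hne : {R : ℝ | 0 ≤ R ∧ StateMAC.AchievableNoState p q1 q2 R}.Nonempty :=
    ⟨0, le_rfl, StateMAC.achievableNoState_zero hq1 (by linarith)⟩
  exact ⟨_, isLUB_csSup hne ⟨G, hub⟩, (csSup_le hne hub).trans_lt hlt⟩
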